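/- Let $\beta\in\mathbb R$. Put $r_i=\frac13$ for $1\le i\le 3$ and $$r_i=\frac13\Big(\frac1i+\frac1{i(\log\log i)^{\beta}}\Big)\qquad\text{for } i\ge 4,$$ and set $p_0=1$ and $p_n=\frac13+r_n$ for $n\ge1$. Assume that $\beta$ is such that $p_n\in(0,1)$ for all $n\ge1$. Let $X=(X_k)_{k\ge0}$ be a Markov chain on $\{0,1,2,\dots\}$, with arbitrary initial distribution, whose transition probabilities are $$P(X_{k+1}=n+2\mid X_k=n)=p_n\ (n\ge0),\qquad P(X_{k+1}=n-1\mid X_k=n)=1-p_n\ (n\ge1).$$ Call a site $k\in\{0,1,2,\dots\}$ a skipped point of $X$ if $X_n\ne k$ for all $n\ge0$. Then: - if $\beta>1$, almost surely $X$ has at most finitely many skipped points; - if $\beta\le1$, then $X$ has infinitely many skipped points with probability at least $\frac{11}{27}$. -/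

import Mathlib

/-- The perturbation `r_i` (meaningful for `i ≥ 1`). -/
noncomputable def perturbation (β : ℝ) (i : ℕ) : ℝ :=
  if i ≤ 3 then 1 / 3
  else (1 / 3) * (1 / (i : ℝ) + 1 / ((i : ℝ) * (Real.log (Real.log (i : ℝ))) ^ β))

/-- The probability `p_n` of the jump `n → n + 2`: `p_0 = 1` and `p_n = 1/3 + r_n` for `n ≥ 1`. -/
noncomputable def upProb (r : ℕ → ℝ) (n : ℕ) : ℝ :=
  if n = 0 then 1 else 1 / 3 + r n

/-- Transition matrix of the (1,2) random walk on `{0, 1, 2, ...}`: from `n` the walk jumps to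
`n + 2` with probability `p n`, and to `n - 1` (when `n ≥ 1`) with probability `1 - p n`. -/
noncomputable def walkTransition (p : ℕ → ℝ) (n m : ℕ) : ℝ :=
  if m = n + 2 then p n else if m + 1 = n then 1 - p n else 0

/-- `X` is a time-homogeneous Markov chain on `ℕ` under `P` with transition matrix `T`
(and an arbitrary initial distribution):
`P(X_0 = x_0, ..., X_{k+1} = x_{k+1}) = P(X_0 = x_0, ..., X_k = x_k) * T x_k x_{k+1}`. -/
structure IsMarkovChainWith {Ω : Type*} [MeasurableSpace Ω] (P : MeasureTheory.Measure Ω)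
    (T : ℕ → ℕ → ℝ) (X : ℕ → Ω → ℕ) : Prop where
  measurable : ∀ k, Measurable (X k)
  markov : ∀ (k : ℕ) (x : ℕ → ℕ),
    P.real {ω | ∀ i ≤ k + 1, X i ω = x i} =
      P.real {ω | ∀ i ≤ k, X i ω = x i} * T (x k) (x (k + 1))

/-- The set of skipped points of the path `n ↦ X n ω`: the sites that are never visited. -/
def skippedPoints {Ω : Type*} (X : ℕ → Ω → ℕ) (ω : Ω) : Set ℕ :=
  {k | ∀ n, X n ω ≠ k}

open MeasureTheory ProbabilityTheory Filter Topology

/-!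
Write `t k = (log log k) ^ (-β) / k`. The products `∏_{j < i ≤ n} (1 - c * t i)` are superharmonic
above `j` for `c < 1` and subharmonic for `c > 1`. Comparing hitting probabilities with them, the
walk started at `k + 1` never visits `k` with probability of order `t k`, and for `j < k` it never
visits `j` with probability of order `min 1 (∑_{j < i ≤ k} t i)`.

For `1 < β`, if some site of a block `[2 a, 8 a)` is skipped, then given the last such site the
expected number of other skipped sites nearby is of order `log a`. Dividing the expected number of
skipped sites by `log a` bounds the probability of a skip by a multiple of
`1 / (log a * (log log a) ^ β)`, which is summable along a geometric sequence of blocks.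

For `β ≤ 1`, the second moment of a weighted number of skipped sites is at most a multiple of the
square of its mean, which diverges. Hence infinitely many sites are skipped with probability bounded
below uniformly in the starting point, and as this event is shift-invariant its probability is one.
-/

/-! ### Measures on path space -/

theorem measure_le_of_isSetAlgebra {α : Type*} [m : MeasurableSpace α] {𝒜 : Set (Set α)}
    (h𝒜 : IsSetAlgebra 𝒜) (hgen : m = MeasurableSpace.generateFrom 𝒜) {μ ν : Measure α}
    [IsFiniteMeasure μ] [IsFiniteMeasure ν] (hle : ∀ s ∈ 𝒜, μ s ≤ ν s) : μ ≤ ν := by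
  refine Measure.le_iff.2 fun s hs => ENNReal.le_of_forall_pos_le_add fun ε hε _ => ?_
  obtain ⟨t, ht, htε⟩ := (Measure.MeasureDense.of_generateFrom_isSetAlgebra_finite (μ + ν)
    h𝒜 hgen).approx s hs (by finiteness) ε (by exact_mod_cast hε)
  rw [ENNReal.ofReal_coe_nnreal, Measure.add_apply] at htε
  calc μ s ≤ μ (symmDiff s t) + μ t :=
        (measure_mono (le_symmDiff_sup_right s t)).trans (measure_union_le _ _)
    _ ≤ μ (symmDiff s t) + (ν (symmDiff s t) + ν s) := by
        gcongr
        exact (hle t ht).trans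
          ((measure_mono (le_symmDiff_sup_left s t)).trans (measure_union_le _ _))
    _ = ν s + (μ (symmDiff s t) + ν (symmDiff s t)) := by ring
    _ ≤ ν s + ε := by gcongr

theorem measure_le_of_singleton_le {α : Type*} [Countable α] [MeasurableSpace α]
    [MeasurableSingletonClass α] {μ ν : Measure α} (hle : ∀ a, μ {a} ≤ ν {a}) : μ ≤ ν := by
  refine Measure.le_iff.2 fun s hs => ?_
  rw [← Measure.tsum_indicator_apply_singleton μ s hs,
    ← Measure.tsum_indicator_apply_singleton ν s hs]
  exact ENNReal.tsum_le_tsum fun a => Set.indicator_le_indicator (hle a)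

section PathSpace

variable {S : Type*}

theorem restrict_Iic_preimage_singleton (n : ℕ) (a : ℕ → S) :
    (Finset.Iic n).restrict (π := fun _ => S) ⁻¹' {(Finset.Iic n).restrict a} =
      {ω | ∀ i ≤ n, ω i = a i} := by
  ext ω
  simp [funext_iff]

/-- The path `x, ω 0, ω 1, …`. -/
def consPath (x : S) (ω : ℕ → S) : ℕ → S
  | 0 => x
  | n + 1 => ω n

theorem consPath_preimage_cylinder_zero (x : S) (a : ℕ → S) :
    consPath x ⁻¹' {ω | ∀ i ≤ 0, ω i = a i} = {_ω | x = a 0} := by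
  ext ω
  simp [consPath]

theorem consPath_preimage_cylinder_succ (x : S) (n : ℕ) (a : ℕ → S) :
    consPath x ⁻¹' {ω | ∀ i ≤ n + 1, ω i = a i} =
      {ω | x = a 0 ∧ ∀ i ≤ n, ω i = a (i + 1)} := by
  ext ω
  refine ⟨fun hω => ⟨hω 0 (by omega), fun i hi => hω (i + 1) (by omega)⟩, fun hω i hi => ?_⟩
  cases i with
  | zero => exact hω.1
  | succ i => exact hω.2 i (by omega)

variable [MeasurableSpace S]

theorem measurable_consPath (x : S) : Measurable (consPath x) := by
  refine measurable_pi_lambda _ fun n => ?_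
  cases n with
  | zero => exact measurable_const
  | succ n => exact measurable_pi_apply n

variable [MeasurableSingletonClass S]

theorem measurableSet_pathCylinder (n : ℕ) (a : ℕ → S) :
    MeasurableSet {ω : ℕ → S | ∀ i ≤ n, ω i = a i} := by
  rw [← restrict_Iic_preimage_singleton]
  exact Finset.measurable_restrict _ (measurableSet_singleton _)

variable [Countable S]

theorem path_measure_le {μ ν : Measure (ℕ → S)} [IsFiniteMeasure μ] [IsFiniteMeasure ν]
    (hle : ∀ (n : ℕ) (a : ℕ → S),
      μ.real {ω | ∀ i ≤ n, ω i = a i} ≤ ν.real {ω | ∀ i ≤ n, ω i = a i}) : μ ≤ ν := by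
  refine measure_le_of_isSetAlgebra isSetAlgebra_measurableCylinders
    generateFrom_measurableCylinders.symm fun s hs => ?_
  rw [measurableCylinders_nat] at hs
  simp only [Set.mem_iUnion, Set.mem_singleton_iff] at hs
  obtain ⟨n, A, hA, rfl⟩ := hs
  suffices h : μ.map (Finset.Iic n).restrict ≤ ν.map (Finset.Iic n).restrict by
    have hle_A := h A
    rwa [Measure.map_apply (Finset.measurable_restrict _) hA,
      Measure.map_apply (Finset.measurable_restrict _) hA] at hle_A
  refine measure_le_of_singleton_le fun b => ?_
  rw [Measure.map_apply (Finset.measurable_restrict _) (measurableSet_singleton b),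
    Measure.map_apply (Finset.measurable_restrict _) (measurableSet_singleton b)]
  rcases ((Finset.Iic n).restrict ⁻¹' {b} : Set (ℕ → S)).eq_empty_or_nonempty with h | ⟨a, rfl⟩
  · simp [h]
  · rw [restrict_Iic_preimage_singleton]
    exact (ENNReal.toReal_le_toReal (by finiteness) (by finiteness)).1 (hle n a)

theorem path_measure_ext {μ ν : Measure (ℕ → S)} [IsFiniteMeasure μ] [IsFiniteMeasure ν]
    (heq : ∀ (n : ℕ) (a : ℕ → S),
      μ.real {ω | ∀ i ≤ n, ω i = a i} = ν.real {ω | ∀ i ≤ n, ω i = a i}) : μ = ν :=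
  le_antisymm (path_measure_le fun n a => (heq n a).le) (path_measure_le fun n a => (heq n a).ge)

end PathSpace

/-! ### Markov chains with a given transition kernel -/

theorem ae_trajMeasure_dirac_zero {S : Type*} [MeasurableSpace S] [MeasurableSingletonClass S]
    (x : S) (κ : (n : ℕ) → Kernel ((i : Finset.Iic n) → S) S) [∀ n, IsMarkovKernel (κ n)] :
    ∀ᵐ ω ∂Kernel.trajMeasure (X := fun _ => S) (Measure.dirac x) κ, ω 0 = x := by
  have hmap : (Kernel.trajMeasure (X := fun _ => S) (Measure.dirac x) κ).map
      (Preorder.frestrictLe 0) = Measure.dirac fun _ => x := by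
    rw [Kernel.trajMeasure, Measure.map_dirac' (by fun_prop), Measure.dirac_bind (by fun_prop),
      ← Kernel.map_apply _ (by fun_prop), Kernel.traj_map_frestrictLe, Kernel.partialTraj_self,
      Kernel.id_apply]
    rfl
  refine ae_of_ae_map (f := Preorder.frestrictLe (π := fun _ => S) 0)
    (p := fun b : (i : Finset.Iic 0) → S => b ⟨0, by simp⟩ = x)
    (Preorder.measurable_frestrictLe 0).aemeasurable ?_
  rw [hmap, ae_dirac_eq]
  exact rfl

theorem exists_isMarkovChainWith (κ : Kernel ℕ ℕ) [IsMarkovKernel κ] (x : ℕ) :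
    ∃ μ : Measure (ℕ → ℕ), IsProbabilityMeasure μ ∧ (∀ᵐ ω ∂μ, ω 0 = x) ∧
      IsMarkovChainWith μ (fun n m => (κ n).real {m}) (fun n ω => ω n) := by
  let κ' (n : ℕ) : Kernel ((i : Finset.Iic n) → ℕ) ℕ :=
    κ.comap (fun a => a ⟨n, by simp⟩) (by fun_prop)
  refine ⟨Kernel.trajMeasure (X := fun _ => ℕ) (Measure.dirac x) κ', inferInstance,
    ae_trajMeasure_dirac_zero x κ', measurable_pi_apply, fun n a => ?_⟩
  set μ := Kernel.trajMeasure (X := fun _ => ℕ) (Measure.dirac x) κ'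
  let aₙ : (i : Finset.Iic n) → ℕ := Preorder.frestrictLe n a
  have hcyl : Preorder.frestrictLe (π := fun _ => ℕ) n ⁻¹' {aₙ} = {ω | ∀ i ≤ n, ω i = a i} :=
    restrict_Iic_preimage_singleton n a
  have hcyl_succ : (fun ω : ℕ → ℕ => (Preorder.frestrictLe (π := fun _ => ℕ) n ω, ω (n + 1))) ⁻¹'
      ({aₙ} ×ˢ {a (n + 1)}) = {ω | ∀ i ≤ n + 1, ω i = a i} := by
    rw [Set.mk_preimage_prod, hcyl]
    ext ω
    simp only [Set.mem_inter_iff, Set.mem_ofPred_eq, Set.mem_preimage, Set.mem_singleton_iff,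
      Nat.le_succ_iff, or_imp, forall_and, forall_eq]
  have hstep := congrArg (fun ρ => ρ ({aₙ} ×ˢ {a (n + 1)}))
    (Kernel.map_frestrictLe_trajMeasure_compProd_eq_map_trajMeasure
      (X := fun _ => ℕ) (κ := κ') (μ₀ := Measure.dirac x) (a := n))
  rw [Measure.compProd_apply_prod (measurableSet_singleton _) (measurableSet_singleton _),
    lintegral_singleton, Measure.map_apply (by fun_prop) (measurableSet_singleton _),
    Measure.map_apply (by fun_prop) ((measurableSet_singleton _).prod (measurableSet_singleton _)),
    hcyl, hcyl_succ] at hstep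
  rw [measureReal_def, ← hstep, ENNReal.toReal_mul, mul_comm]
  rfl

theorem IsMarkovChainWith.real_cylinder_eq_prod {Ω : Type*} [MeasurableSpace Ω] {P : Measure Ω}
    {T : ℕ → ℕ → ℝ} {X : ℕ → Ω → ℕ} (hX : IsMarkovChainWith P T X) (n : ℕ) (a : ℕ → ℕ) :
    P.real {ω | ∀ i ≤ n, X i ω = a i} =
      P.real {ω | X 0 ω = a 0} * ∏ i ∈ Finset.range n, T (a i) (a (i + 1)) := by
  induction n with
  | zero => simp
  | succ n ih => rw [hX.markov, ih, Finset.prod_range_succ, mul_assoc]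

/-! ### The walk from each starting point -/

/-- The sequence `p` is admissible as the up-probabilities of a walk on `ℕ` reflected at `0`. -/
structure IsUpProb (p : ℕ → ℝ) : Prop where
  zero : p 0 = 1
  pos : ∀ n, 0 < p n
  le_one : ∀ n, p n ≤ 1

-- The truncated subtraction `0 - 1 = 0` is harmless because `1 - p 0 = 0`.
theorem IsUpProb.walkTransition_eq {p : ℕ → ℝ} (hp : IsUpProb p) (n m : ℕ) :
    walkTransition p n m =
      p n * (if m = n + 2 then 1 else 0) + (1 - p n) * (if m = n - 1 then 1 else 0) := by
  rcases n.eq_zero_or_pos with rfl | hn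
  · simp [walkTransition, hp.zero]
  · simp only [walkTransition, show m + 1 = n ↔ m = n - 1 by omega]
    split_ifs <;> first | omega | simp

/-- The law of the position of the walk one step after `n`. -/
noncomputable def stepMeasure (p : ℕ → ℝ) (n : ℕ) : Measure ℕ :=
  ENNReal.ofReal (p n) • Measure.dirac (n + 2) + ENNReal.ofReal (1 - p n) • Measure.dirac (n - 1)

theorem IsUpProb.isProbabilityMeasure_stepMeasure {p : ℕ → ℝ} (hp : IsUpProb p) (n : ℕ) :
    IsProbabilityMeasure (stepMeasure p n) :=
  ⟨by simp [stepMeasure, ← ENNReal.ofReal_add (hp.pos n).le (sub_nonneg.2 (hp.le_one n))]⟩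

theorem real_ofReal_smul_add_ofReal_smul {α : Type*} [MeasurableSpace α] {μ ν : Measure α}
    [IsFiniteMeasure μ] [IsFiniteMeasure ν] {a b : ℝ} (ha : 0 ≤ a) (hb : 0 ≤ b) (s : Set α) :
    (ENNReal.ofReal a • μ + ENNReal.ofReal b • ν).real s = a * μ.real s + b * ν.real s := by
  simp only [measureReal_def, Measure.add_apply, Measure.smul_apply, smul_eq_mul]
  rw [ENNReal.toReal_add (by finiteness) (by finiteness), ENNReal.toReal_mul, ENNReal.toReal_mul,
    ENNReal.toReal_ofReal ha, ENNReal.toReal_ofReal hb]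

theorem IsUpProb.real_stepMeasure_singleton {p : ℕ → ℝ} (hp : IsUpProb p) (n m : ℕ) :
    (stepMeasure p n).real {m} = walkTransition p n m := by
  rw [hp.walkTransition_eq, stepMeasure,
    real_ofReal_smul_add_ofReal_smul (hp.pos n).le (sub_nonneg.2 (hp.le_one n))]
  simp [measureReal_def, Set.indicator_apply, apply_ite ENNReal.toReal, @eq_comm _ m]

/-- `Q x` is the law of the walk with up-probabilities `p` started at `x`. -/
structure IsWalkFamily (p : ℕ → ℝ) (Q : ℕ → Measure (ℕ → ℕ)) : Prop where
  isUpProb : IsUpProb p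
  isProbabilityMeasure : ∀ x, IsProbabilityMeasure (Q x)
  start : ∀ x, ∀ᵐ ω ∂Q x, ω 0 = x
  chain : ∀ x, IsMarkovChainWith (Q x) (walkTransition p) (fun n ω => ω n)

theorem IsUpProb.exists_isWalkFamily {p : ℕ → ℝ} (hp : IsUpProb p) : ∃ Q, IsWalkFamily p Q := by
  let κ : Kernel ℕ ℕ := Kernel.ofFunOfCountable (stepMeasure p)
  have : IsMarkovKernel κ := ⟨hp.isProbabilityMeasure_stepMeasure⟩
  choose Q hprob hstart hchain using exists_isMarkovChainWith κ
  have hκ : (fun n m => (κ n).real {m}) = walkTransition p :=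
    funext₂ hp.real_stepMeasure_singleton
  exact ⟨Q, hp, hprob, hstart, fun x => hκ ▸ hchain x⟩

namespace IsWalkFamily

variable {p : ℕ → ℝ} {Q : ℕ → Measure (ℕ → ℕ)}

theorem real_start (h : IsWalkFamily p Q) (x a : ℕ) :
    (Q x).real {ω | ω 0 = a} = if x = a then 1 else 0 := by
  have := h.isProbabilityMeasure
  have hae : {ω : ℕ → ℕ | ω 0 = a} =ᵐ[Q x] {_ω | x = a} := by
    filter_upwards [h.start x] with ω hω
    exact congrArg (· = a) hω
  rw [measureReal_congr hae]
  split_ifs with hax <;> simp [hax]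

theorem real_cylinder_eq_prod (h : IsWalkFamily p Q) (x n : ℕ) (a : ℕ → ℕ) :
    (Q x).real {ω | ∀ i ≤ n, ω i = a i} =
      (if x = a 0 then 1 else 0) * ∏ i ∈ Finset.range n, walkTransition p (a i) (a (i + 1)) := by
  rw [(h.chain x).real_cylinder_eq_prod, h.real_start]

theorem eq_map_consPath (h : IsWalkFamily p Q) (x : ℕ) :
    Q x = ENNReal.ofReal (p x) • (Q (x + 2)).map (consPath x) +
      ENNReal.ofReal (1 - p x) • (Q (x - 1)).map (consPath x) := by
  have := h.isProbabilityMeasure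
  have (μ : Measure (ℕ → ℕ)) [IsFiniteMeasure μ] (c : ℝ) : IsFiniteMeasure (ENNReal.ofReal c • μ) :=
    Measure.smul_finite μ ENNReal.ofReal_ne_top
  refine path_measure_ext fun n a => ?_
  rw [real_ofReal_smul_add_ofReal_smul (h.isUpProb.pos x).le (sub_nonneg.2 (h.isUpProb.le_one x)),
    map_measureReal_apply (measurable_consPath x) (measurableSet_pathCylinder n a),
    map_measureReal_apply (measurable_consPath x) (measurableSet_pathCylinder n a),
    h.real_cylinder_eq_prod]
  cases n with
  | zero =>
    rw [consPath_preimage_cylinder_zero]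
    split_ifs with hx <;> simp [hx]
  | succ n =>
    rw [consPath_preimage_cylinder_succ]
    split_ifs with hx
    · subst hx
      simp only [true_and]
      rw [h.real_cylinder_eq_prod (a 0 + 2) n (fun i => a (i + 1)),
        h.real_cylinder_eq_prod (a 0 - 1) n (fun i => a (i + 1)), Finset.prod_range_succ',
        h.isUpProb.walkTransition_eq (a 0)]
      simp only [zero_add, @eq_comm _ (a 1)]
      ring
    · simp [hx]

theorem first_step (h : IsWalkFamily p Q) (x : ℕ) {D : Set (ℕ → ℕ)} (hD : MeasurableSet D) :
    (Q x).real D = p x * (Q (x + 2)).real (consPath x ⁻¹' D) +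
      (1 - p x) * (Q (x - 1)).real (consPath x ⁻¹' D) := by
  have := h.isProbabilityMeasure
  rw [h.eq_map_consPath x, real_ofReal_smul_add_ofReal_smul (h.isUpProb.pos x).le
    (sub_nonneg.2 (h.isUpProb.le_one x)), map_measureReal_apply (measurable_consPath x) hD,
    map_measureReal_apply (measurable_consPath x) hD]

theorem map_eq_sum (h : IsWalkFamily p Q) {Ω : Type*} [MeasurableSpace Ω] {P : Measure Ω}
    [IsProbabilityMeasure P] {X : ℕ → Ω → ℕ} (hX : IsMarkovChainWith P (walkTransition p) X) :
    P.map (fun ω n => X n ω) = Measure.sum fun x => P {ω | X 0 ω = x} • Q x := by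
  have := h.isProbabilityMeasure
  have hmeas : Measurable (fun ω n => X n ω) := measurable_pi_lambda _ hX.measurable
  have htotal : ∑' x, P {ω | X 0 ω = x} = 1 := by
    rw [← measure_univ (μ := P), ← Set.preimage_univ (f := X 0), ← Measure.map_apply
      (hX.measurable 0) .univ, ← Measure.tsum_indicator_apply_singleton _ _ .univ]
    simp [Measure.map_apply (hX.measurable 0), Set.preimage, Set.indicator]
  have : IsFiniteMeasure (Measure.sum fun x => P {ω | X 0 ω = x} • Q x) :=
    ⟨by simp [Measure.sum_apply _ .univ, htotal]⟩
  refine path_measure_ext fun n a => ?_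
  have hcyl := measurableSet_pathCylinder n a
  rw [map_measureReal_apply hmeas hcyl, measureReal_def (μ := Measure.sum _),
    Measure.sum_apply _ hcyl, tsum_eq_single (a 0)]
  · rw [Measure.smul_apply, smul_eq_mul, ENNReal.toReal_mul]
    refine (hX.real_cylinder_eq_prod n a).trans ?_
    rw [← measureReal_def (μ := Q _), h.real_cylinder_eq_prod, if_pos rfl, one_mul, measureReal_def]
  · intro x hx
    have hnull : (Q x).real {ω | ∀ i ≤ n, ω i = a i} = 0 := by
      rw [h.real_cylinder_eq_prod, if_neg hx, zero_mul]
    rw [Measure.smul_apply, (measureReal_eq_zero_iff).1 hnull, smul_zero]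

theorem ae_of_forall_ae (h : IsWalkFamily p Q) {Ω : Type*} [MeasurableSpace Ω] {P : Measure Ω}
    [IsProbabilityMeasure P] {X : ℕ → Ω → ℕ} (hX : IsMarkovChainWith P (walkTransition p) X)
    {A : (ℕ → ℕ) → Prop} (hA : ∀ x, ∀ᵐ ω ∂Q x, A ω) : ∀ᵐ ω ∂P, A fun n => X n ω := by
  refine ae_of_ae_map (measurable_pi_lambda _ hX.measurable).aemeasurable ?_
  rw [h.map_eq_sum hX, Measure.ae_sum_iff]
  exact fun x => Measure.ae_smul_measure (hA x) _

/-! ### A zero-one law for shift-invariant events -/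

theorem real_inter_cylinder_le (h : IsWalkFamily p Q) {D : Set (ℕ → ℕ)} (hD : MeasurableSet D)
    (hinv : ∀ x, consPath x ⁻¹' D = D) {c : ℝ} (hc : ∀ x, (Q x).real D ≤ c) (x n : ℕ)
    (a : ℕ → ℕ) :
    (Q x).real (D ∩ {ω | ∀ i ≤ n, ω i = a i}) ≤ c * (Q x).real {ω | ∀ i ≤ n, ω i = a i} := by
  have := h.isProbabilityMeasure
  induction n generalizing x a with
  | zero =>
    rw [h.real_cylinder_eq_prod]
    split_ifs with hx
    · simpa using (measureReal_mono Set.inter_subset_left).trans (hc x)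
    · refine (measureReal_mono Set.inter_subset_right).trans ?_
      rw [h.real_cylinder_eq_prod, if_neg hx]
      simp
  | succ n ih =>
    have hcyl := measurableSet_pathCylinder (n + 1) a
    rw [h.first_step x (hD.inter hcyl), h.first_step x hcyl, Set.preimage_inter, hinv,
      consPath_preimage_cylinder_succ]
    by_cases hx : x = a 0
    · have hp0 := (h.isUpProb.pos x).le
      have hp1 := sub_nonneg.2 (h.isUpProb.le_one x)
      simp only [hx, true_and] at hp0 hp1 ⊢
      linarith [mul_le_mul_of_nonneg_left (ih (a 0 + 2) fun i => a (i + 1)) hp0,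
        mul_le_mul_of_nonneg_left (ih (a 0 - 1) fun i => a (i + 1)) hp1]
    · simp [hx]

-- The bound on cylinders extends to all events, in particular to `D` itself.
theorem measure_eq_zero_of_invariant (h : IsWalkFamily p Q) {D : Set (ℕ → ℕ)}
    (hD : MeasurableSet D) (hinv : ∀ x, consPath x ⁻¹' D = D) {c : ℝ} (hc1 : c < 1)
    (hc : ∀ x, (Q x).real D ≤ c) (x : ℕ) : Q x D = 0 := by
  have := h.isProbabilityMeasure
  have hc0 : 0 ≤ c := measureReal_nonneg.trans (hc 0)
  have : IsFiniteMeasure (ENNReal.ofReal c • Q x) :=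
    Measure.smul_finite _ ENNReal.ofReal_ne_top
  have hle : (Q x).restrict D ≤ ENNReal.ofReal c • Q x := path_measure_le fun n a => by
    rw [measureReal_restrict_apply (measurableSet_pathCylinder n a), measureReal_ennreal_smul_apply,
      ENNReal.toReal_ofReal hc0, Set.inter_comm]
    exact h.real_inter_cylinder_le hD hinv hc x n a
  have hself : (Q x).real D ≤ c * (Q x).real D := by
    have := ENNReal.toReal_mono (by finiteness) (hle D)
    rwa [Measure.restrict_apply_self, Measure.smul_apply, smul_eq_mul, ENNReal.toReal_mul,
      ENNReal.toReal_ofReal hc0] at this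
  rw [← measureReal_eq_zero_iff]
  nlinarith [measureReal_nonneg (μ := Q x) (s := D)]

end IsWalkFamily

/-! ### Sub- and superharmonic functions of the walk -/

/-- The average of `f` over the position of the walk one step after `n`. -/
def walkAvg (p f : ℕ → ℝ) (n : ℕ) : ℝ := p n * f (n + 2) + (1 - p n) * f (n - 1)

/-- `f` is at most its one-step average at every point of `s`. -/
def SubharmonicOn (p : ℕ → ℝ) (s : Set ℕ) (f : ℕ → ℝ) : Prop := ∀ n ∈ s, f n ≤ walkAvg p f n

/-- `f` is at least its one-step average at every point of `s`. -/
def SuperharmonicOn (p : ℕ → ℝ) (s : Set ℕ) (f : ℕ → ℝ) : Prop := ∀ n ∈ s, walkAvg p f n ≤ f n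

/-- `f` equals its one-step average at every point of `s`. -/
def HarmonicOn (p : ℕ → ℝ) (s : Set ℕ) (f : ℕ → ℝ) : Prop := ∀ n ∈ s, walkAvg p f n = f n

section Harmonic

variable {p f g : ℕ → ℝ} {s : Set ℕ}

theorem walkAvg_const_mul (p f : ℕ → ℝ) (c : ℝ) (n : ℕ) :
    walkAvg p (fun m => c * f m) n = c * walkAvg p f n := by
  unfold walkAvg; ring

theorem walkAvg_const_sub (p f : ℕ → ℝ) (c : ℝ) (n : ℕ) :
    walkAvg p (fun m => c - f m) n = c - walkAvg p f n := by
  unfold walkAvg; ring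

theorem HarmonicOn.subharmonicOn (hf : HarmonicOn p s f) : SubharmonicOn p s f :=
  fun n hn => (hf n hn).ge

theorem HarmonicOn.superharmonicOn (hf : HarmonicOn p s f) : SuperharmonicOn p s f :=
  fun n hn => (hf n hn).le

theorem HarmonicOn.const_mul (hf : HarmonicOn p s f) (c : ℝ) :
    HarmonicOn p s fun n => c * f n := fun n hn => by rw [walkAvg_const_mul, hf n hn]

theorem harmonicOn_const (p : ℕ → ℝ) (s : Set ℕ) (c : ℝ) : HarmonicOn p s fun _ => c :=
  fun _ _ => by unfold walkAvg; ring

theorem SubharmonicOn.mul_const_sub (hf : SubharmonicOn p s f) {a : ℝ} (ha : 0 ≤ a) (c : ℝ) :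
    SuperharmonicOn p s fun n => a * (c - f n) := fun n hn => by
  rw [walkAvg_const_mul p (fun n => c - f n), walkAvg_const_sub]
  exact mul_le_mul_of_nonneg_left (sub_le_sub_left (hf n hn) c) ha

theorem SuperharmonicOn.mul_const_sub (hf : SuperharmonicOn p s f) {a : ℝ} (ha : 0 ≤ a) (c : ℝ) :
    SubharmonicOn p s fun n => a * (c - f n) := fun n hn => by
  rw [walkAvg_const_mul p (fun n => c - f n), walkAvg_const_sub]
  exact mul_le_mul_of_nonneg_left (sub_le_sub_left (hf n hn) c) ha

-- At the last point where the maximum of `f - g` is attained, an up-jump strictly decreases it.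
theorem SubharmonicOn.le_of_boundary (hp : IsUpProb p) (hf : SubharmonicOn p s f)
    (hg : SuperharmonicOn p s g) {t : Finset ℕ} (hst : ∀ n ∈ s, n + 2 ∈ t ∧ n - 1 ∈ t)
    (hbd : ∀ n ∈ t, n ∉ s → f n ≤ g n) {n : ℕ} (hn : n ∈ t) : f n ≤ g n := by
  by_contra! hpos
  obtain ⟨m, hm, hmax⟩ := t.exists_max_image (fun i => f i - g i) ⟨n, hn⟩
  obtain ⟨l, hl, hlast⟩ := (t.filter fun i => f i - g i = f m - g m).exists_max_image id
    ⟨m, by simpa using hm⟩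
  obtain ⟨hlt, hlm⟩ := Finset.mem_filter.1 hl
  have hmpos : 0 < f m - g m := (sub_pos.2 hpos).trans_le (hmax n hn)
  have hls : l ∈ s := by
    by_contra hls
    linarith [hbd l hlt hls]
  have hup : f (l + 2) - g (l + 2) < f m - g m :=
    lt_of_le_of_ne (hmax _ (hst l hls).1) fun heq => by
      have := hlast (l + 2) (Finset.mem_filter.2 ⟨(hst l hls).1, heq⟩)
      simp at this
  have hdown : f (l - 1) - g (l - 1) ≤ f m - g m := hmax _ (hst l hls).2
  have hfl := hf l hls
  have hgl := hg l hls
  unfold walkAvg at hfl hgl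
  linarith [mul_lt_mul_of_pos_left hup (hp.pos l),
    mul_le_mul_of_nonneg_left hdown (sub_nonneg.2 (hp.le_one l))]

theorem SubharmonicOn.le_of_Iio (hp : IsUpProb p) {k : ℕ} (hf : SubharmonicOn p (Set.Iio k) f)
    (hg : SuperharmonicOn p (Set.Iio k) g) (hk : f k ≤ g k) (hk1 : f (k + 1) ≤ g (k + 1))
    {n : ℕ} (hn : n ≤ k + 1) : f n ≤ g n := by
  refine hf.le_of_boundary hp hg (t := Finset.Iic (k + 1)) (fun m hm => ?_) (fun m hm hmk => ?_)
    (Finset.mem_Iic.2 hn)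
  · simp only [Set.mem_Iio] at hm
    simp only [Finset.mem_Iic]
    omega
  · simp only [Finset.mem_Iic, Set.mem_Iio] at hm hmk
    obtain rfl | rfl : m = k ∨ m = k + 1 := by omega
    exacts [hk, hk1]

theorem SubharmonicOn.le_of_Ioo (hp : IsUpProb p) {a k : ℕ}
    (hf : SubharmonicOn p (Set.Ioo a k) f) (hg : SuperharmonicOn p (Set.Ioo a k) g)
    (ha : f a ≤ g a) (hk : f k ≤ g k) (hk1 : f (k + 1) ≤ g (k + 1))
    {n : ℕ} (han : a ≤ n) (hn : n ≤ k + 1) : f n ≤ g n := by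
  refine hf.le_of_boundary hp hg (t := Finset.Icc a (k + 1)) (fun m hm => ?_)
    (fun m hm hmk => ?_) (Finset.mem_Icc.2 ⟨han, hn⟩)
  · simp only [Set.mem_Ioo] at hm
    simp only [Finset.mem_Icc]
    omega
  · simp only [Finset.mem_Icc, Set.mem_Ioo] at hm hmk
    obtain rfl | rfl | rfl : m = a ∨ m = k ∨ m = k + 1 := by omega
    exacts [ha, hk, hk1]

end Harmonic

/-! ### Skipping events -/

/-- The event that the path never visits `k`. -/
def skipEvent (k : ℕ) : Set (ℕ → ℕ) := {ω | ∀ n, ω n ≠ k}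

theorem measurableSet_skipEvent (k : ℕ) : MeasurableSet (skipEvent k) := by
  rw [show skipEvent k = ⋂ n, (fun ω : ℕ → ℕ => ω n) ⁻¹' {k}ᶜ by ext; simp [skipEvent]]
  exact .iInter fun n => measurable_pi_apply n (measurableSet_singleton k).compl

theorem consPath_mem_skipEvent {x k : ℕ} {ω : ℕ → ℕ} :
    consPath x ω ∈ skipEvent k ↔ x ≠ k ∧ ω ∈ skipEvent k := by
  refine ⟨fun h => ⟨h 0, fun n => h (n + 1)⟩, fun ⟨h0, h⟩ n => ?_⟩
  cases n with
  | zero => exact h0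
  | succ n => exact h n

theorem preimage_consPath_skipEvent {x k : ℕ} (hx : x ≠ k) :
    consPath x ⁻¹' skipEvent k = skipEvent k := by
  ext ω
  simp [consPath_mem_skipEvent, hx]

/-- The probability that the walk started at `x` never visits `k`. -/
noncomputable def skipProb (Q : ℕ → Measure (ℕ → ℕ)) (k x : ℕ) : ℝ := (Q x).real (skipEvent k)

/-- The escape probability of `k`: the walk started at `k + 1` never visits `k`. -/
noncomputable def escProb (Q : ℕ → Measure (ℕ → ℕ)) (k : ℕ) : ℝ := skipProb Q k (k + 1)

namespace IsWalkFamily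

variable {p : ℕ → ℝ} {Q : ℕ → Measure (ℕ → ℕ)}

theorem real_le_one (h : IsWalkFamily p Q) (x : ℕ) (D : Set (ℕ → ℕ)) : (Q x).real D ≤ 1 :=
  have := h.isProbabilityMeasure x
  measureReal_le_one

theorem real_mono (h : IsWalkFamily p Q) (x : ℕ) {D E : Set (ℕ → ℕ)} (hDE : D ⊆ E) :
    (Q x).real D ≤ (Q x).real E :=
  have := h.isProbabilityMeasure x
  measureReal_mono hDE

theorem harmonicOn_real (h : IsWalkFamily p Q) {s : Set ℕ} {D : Set (ℕ → ℕ)}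
    (hD : MeasurableSet D) (hs : ∀ x ∈ s, consPath x ⁻¹' D = D) :
    HarmonicOn p s fun x => (Q x).real D := fun x hx => by
  change walkAvg p _ x = (Q x).real D
  rw [h.first_step x hD, hs x hx, walkAvg]

theorem real_eq_zero_of_subset_skipEvent (h : IsWalkFamily p Q) {k : ℕ} {D : Set (ℕ → ℕ)}
    (hD : D ⊆ skipEvent k) : (Q k).real D = 0 := by
  refine le_antisymm ((h.real_mono k hD).trans ?_) measureReal_nonneg
  rw [h.first_step k (measurableSet_skipEvent k), show consPath k ⁻¹' skipEvent k = ∅ by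
    ext ω; simp [consPath_mem_skipEvent]]
  simp

-- Downward jumps have size one, so the walk cannot pass below `k` without visiting it.
theorem ae_lt_of_mem_skipEvent (h : IsWalkFamily p Q) {k n : ℕ} (hn : k < n) :
    ∀ᵐ ω ∂Q n, ω ∈ skipEvent k → ∀ t, k < ω t := by
  have := h.isProbabilityMeasure
  have hmeas (t : ℕ) : MeasurableSet ({ω : ℕ → ℕ | ω t ≤ k} ∩ skipEvent k) :=
    (measurableSet_le (measurable_pi_apply t) measurable_const).inter (measurableSet_skipEvent k)
  have hnull (t : ℕ) : ∀ n, k < n → (Q n).real ({ω | ω t ≤ k} ∩ skipEvent k) = 0 := by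
    induction t with
    | zero =>
      intro n hn
      rw [measureReal_eq_zero_iff]
      refine measure_mono_null Set.inter_subset_left (measure_eq_zero_iff_ae_notMem.2 ?_)
      filter_upwards [h.start n] with ω hω
      simp [hω, hn]
    | succ t ih =>
      intro n hn
      have hcons : consPath n ⁻¹' ({ω | ω (t + 1) ≤ k} ∩ skipEvent k) =
          {ω | ω t ≤ k} ∩ skipEvent k := by
        rw [Set.preimage_inter, preimage_consPath_skipEvent hn.ne']; rfl
      have hpred : (Q (n - 1)).real ({ω | ω t ≤ k} ∩ skipEvent k) = 0 := by
        obtain hlt | heq : k < n - 1 ∨ k = n - 1 := by omega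
        · exact ih _ hlt
        · exact heq ▸ h.real_eq_zero_of_subset_skipEvent Set.inter_subset_right
      rw [h.first_step n (hmeas _), hcons, ih _ (by omega), hpred]
      simp
  have hae (t : ℕ) : ∀ᵐ ω ∂Q n, ¬(ω t ≤ k ∧ ω ∈ skipEvent k) :=
    measure_eq_zero_iff_ae_notMem.1 ((measureReal_eq_zero_iff).1 (hnull t n hn))
  filter_upwards [ae_all_iff.2 hae] with ω hω hskip t
  exact not_le.1 fun hle => hω t ⟨hle, hskip⟩

/-! ### Comparison of path probabilities with barriers -/

theorem real_exists_le_mul_le (h : IsWalkFamily p Q) {j : ℕ} {H : ℕ → ℝ}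
    (hH : SuperharmonicOn p (Set.Ioi j) H) (hH0 : ∀ n, j ≤ n → 0 ≤ H n) (t : ℕ) {n : ℕ}
    (hn : j ≤ n) : (Q n).real {ω | ∃ s ≤ t, ω s = j} * H j ≤ H n := by
  induction t generalizing n with
  | zero =>
    simp only [nonpos_iff_eq_zero, exists_eq_left, h.real_start]
    split_ifs with hnj
    · simp [hnj]
    · simpa using hH0 n hn
  | succ t ih =>
    rcases hn.eq_or_lt with rfl | hlt
    · exact mul_le_of_le_one_left (hH0 _ le_rfl) (h.real_le_one _ _)
    · have hmeas : MeasurableSet {ω : ℕ → ℕ | ∃ s ≤ t + 1, ω s = j} := by measurability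
      have hcons : consPath n ⁻¹' {ω | ∃ s ≤ t + 1, ω s = j} = {ω | ∃ s ≤ t, ω s = j} := by
        ext ω
        refine ⟨?_, fun ⟨s, hs, hsj⟩ => ⟨s + 1, by omega, hsj⟩⟩
        rintro ⟨_ | s, hs, hsj⟩
        · exact absurd hsj hlt.ne'
        · exact ⟨s, by omega, hsj⟩
      rw [h.first_step n hmeas, hcons]
      have hup := mul_le_mul_of_nonneg_left (ih (show j ≤ n + 2 by omega)) (h.isUpProb.pos n).le
      have hdown := mul_le_mul_of_nonneg_left (ih (show j ≤ n - 1 by omega))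
        (sub_nonneg.2 (h.isUpProb.le_one n))
      have hsuper := hH n hlt
      unfold walkAvg at hsuper
      linarith

theorem one_sub_skipProb_mul_le (h : IsWalkFamily p Q) {j : ℕ} {H : ℕ → ℝ}
    (hH : SuperharmonicOn p (Set.Ioi j) H) (hH0 : ∀ n, j ≤ n → 0 ≤ H n) {n : ℕ} (hn : j ≤ n) :
    (1 - skipProb Q j n) * H j ≤ H n := by
  have := h.isProbabilityMeasure
  have hunion : (skipEvent j)ᶜ = ⋃ t, {ω : ℕ → ℕ | ∃ s ≤ t, ω s = j} := by
    ext ω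
    simp only [skipEvent, Set.mem_compl_iff, Set.mem_ofPred_eq, not_forall, not_not,
      Set.mem_iUnion]
    exact ⟨fun ⟨s, hs⟩ => ⟨s, s, le_rfl, hs⟩, fun ⟨_, s, _, hs⟩ => ⟨s, hs⟩⟩
  have hmono : Monotone fun t => {ω : ℕ → ℕ | ∃ s ≤ t, ω s = j} :=
    fun _ _ htt _ ⟨s, hs, hsj⟩ => ⟨s, hs.trans htt, hsj⟩
  have hlim : Tendsto (fun t => (Q n).real {ω | ∃ s ≤ t, ω s = j}) atTop
      (𝓝 (1 - skipProb Q j n)) := by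
    rw [skipProb, ← probReal_compl_eq_one_sub (measurableSet_skipEvent j), hunion]
    exact (ENNReal.tendsto_toReal (measure_ne_top _ _)).comp (tendsto_measure_iUnion_atTop hmono)
  exact le_of_tendsto (hlim.mul_const (H j))
    (Eventually.of_forall fun t => h.real_exists_le_mul_le hH hH0 t hn)

theorem real_mul_sub_le (h : IsWalkFamily p Q) {j k : ℕ} {D : Set (ℕ → ℕ)} {G : ℕ → ℝ} {M : ℝ}
    (hD : MeasurableSet D) (hDj : D ⊆ skipEvent j)
    (hDc : ∀ x ∈ Set.Ioo j k, consPath x ⁻¹' D = D)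
    (hDk : (Q k).real D ≤ M) (hDk1 : (Q (k + 1)).real D ≤ M)
    (hG : SubharmonicOn p (Set.Ioo j k) G) (hkj : G k ≤ G j) (hk1 : G (k + 1) ≤ G k)
    {n : ℕ} (hjn : j ≤ n) (hnk : n ≤ k + 1) :
    (Q n).real D * (G j - G k) ≤ M * (G j - G n) := by
  have hM : 0 ≤ M := measureReal_nonneg.trans hDk
  rw [mul_comm]
  refine ((h.harmonicOn_real hD hDc).const_mul (G j - G k)).subharmonicOn.le_of_Ioo h.isUpProb
    (hG.mul_const_sub hM (G j)) ?_ ?_ ?_ hjn hnk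
  · simp [h.real_eq_zero_of_subset_skipEvent hDj]
  · nlinarith
  · nlinarith

-- A path from below `j` that skips `j` first exceeds `j` at `j + 1`.
theorem real_mul_escProb (h : IsWalkFamily p Q) {j : ℕ} {D : Set (ℕ → ℕ)}
    (hD : MeasurableSet D) (hDj : D ⊆ skipEvent j) (hDc : ∀ x < j, consPath x ⁻¹' D = D)
    {x : ℕ} (hx : x ≤ j + 1) :
    (Q x).real D * escProb Q j = skipProb Q j x * (Q (j + 1)).real D := by
  have hDzero : (Q j).real D = 0 := h.real_eq_zero_of_subset_skipEvent hDj
  have hskipzero : skipProb Q j j = 0 := h.real_eq_zero_of_subset_skipEvent subset_rfl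
  have hleft := (h.harmonicOn_real (s := Set.Iio j) hD hDc).const_mul (escProb Q j)
  have hright := (h.harmonicOn_real (s := Set.Iio j) (measurableSet_skipEvent j)
    fun x hx => preimage_consPath_skipEvent (ne_of_lt hx)).const_mul ((Q (j + 1)).real D)
  rw [mul_comm, mul_comm (skipProb Q j x)]
  refine le_antisymm
    (hleft.subharmonicOn.le_of_Iio h.isUpProb hright.superharmonicOn ?_ ?_ hx)
    (hright.subharmonicOn.le_of_Iio h.isUpProb hleft.superharmonicOn ?_ ?_ hx)
  · exact (by rw [hDzero, mul_zero, ← skipProb, hskipzero, mul_zero] : _ = _).le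
  · exact (mul_comm _ _).le
  · exact (by rw [hDzero, mul_zero, ← skipProb, hskipzero, mul_zero] : _ = _).le
  · exact (mul_comm _ _).le

theorem real_le_real_succ (h : IsWalkFamily p Q) {j : ℕ} {D : Set (ℕ → ℕ)}
    (hD : MeasurableSet D) (hDj : D ⊆ skipEvent j) (hDc : ∀ x < j, consPath x ⁻¹' D = D)
    {x : ℕ} (hx : x ≤ j + 1) : (Q x).real D ≤ (Q (j + 1)).real D :=
  (h.harmonicOn_real (s := Set.Iio j) hD hDc).subharmonicOn.le_of_Iio h.isUpProb
    (harmonicOn_const p _ ((Q (j + 1)).real D)).superharmonicOn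
    ((h.real_eq_zero_of_subset_skipEvent hDj).trans_le measureReal_nonneg) le_rfl hx

end IsWalkFamily

theorem HarmonicOn.div_eighteen_le {p f : ℕ → ℝ} {k : ℕ} (hf : HarmonicOn p (Set.Icc k (k + 2)) f)
    (hf0 : ∀ n, 0 ≤ f n) (hp : ∀ n ∈ Set.Icc k (k + 2), p n ∈ Set.Icc (1 / 3 : ℝ) (1 / 2)) :
    f (k + 4) / 18 ≤ f (k + 1) ∧ f (k + 4) / 18 ≤ f (k + 2) := by
  have hup (n : ℕ) (hn : n ∈ Set.Icc k (k + 2)) : f (n + 2) / 3 ≤ f n := by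
    have := hf n hn
    unfold walkAvg at this
    linarith [mul_le_mul_of_nonneg_right (hp n hn).1 (hf0 (n + 2)),
      mul_nonneg (show 0 ≤ 1 - p n by linarith [(hp n hn).2]) (hf0 (n - 1))]
  have hdown : f k / 2 ≤ f (k + 1) := by
    have hmem : k + 1 ∈ Set.Icc k (k + 2) := ⟨by omega, by omega⟩
    have := hf (k + 1) hmem
    rw [walkAvg, Nat.add_sub_cancel] at this
    linarith [mul_le_mul_of_nonneg_right (show 1 / 2 ≤ 1 - p (k + 1) by
      linarith [(hp _ hmem).2]) (hf0 k),
      mul_nonneg (show 0 ≤ p (k + 1) by linarith [(hp _ hmem).1]) (hf0 (k + 1 + 2))]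
  have hk := hup k ⟨le_rfl, by omega⟩
  have hk2 : f (k + 4) / 3 ≤ f (k + 2) := hup (k + 2) ⟨by omega, le_rfl⟩
  constructor <;> linarith [hf0 (k + 4), hf0 (k + 2)]

namespace IsWalkFamily

variable {p : ℕ → ℝ} {Q : ℕ → Measure (ℕ → ℕ)}

theorem div_eighteen_le_real (h : IsWalkFamily p Q) {j : ℕ} {D : Set (ℕ → ℕ)}
    (hD : MeasurableSet D) (hDc : ∀ x < j + 3, consPath x ⁻¹' D = D)
    (hp : ∀ n ∈ Set.Icc j (j + 2), p n ∈ Set.Icc (1 / 3 : ℝ) (1 / 2)) {x : ℕ} (hx : x ≤ j + 2) :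
    (Q (j + 4)).real D / 18 ≤ (Q x).real D := by
  have hharm : HarmonicOn p (Set.Iio (j + 3)) fun n => (Q n).real D := h.harmonicOn_real hD hDc
  obtain ⟨hj1, hj2⟩ := HarmonicOn.div_eighteen_le (k := j)
    (fun n hn => hharm n (show n < j + 3 by have := hn.2; omega)) (fun _ => measureReal_nonneg) hp
  exact (harmonicOn_const p (Set.Iio (j + 1)) ((Q (j + 4)).real D / 18)).subharmonicOn.le_of_Iio
    h.isUpProb (fun n hn => (hharm n (by simp only [Set.mem_Iio] at hn ⊢; omega)).le) hj1 hj2 hx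

theorem div_eighteen_mul_sub_le (h : IsWalkFamily p Q) {j k : ℕ} {D : Set (ℕ → ℕ)} {H : ℕ → ℝ}
    (hD : MeasurableSet D) (hDj : D ⊆ skipEvent j)
    (hDc : ∀ x ∈ Set.Ioo j (k + 3), consPath x ⁻¹' D = D) (hjk : j < k)
    (hp : ∀ n ∈ Set.Icc k (k + 2), p n ∈ Set.Icc (1 / 3 : ℝ) (1 / 2))
    (hH : SuperharmonicOn p (Set.Ioo j (k + 1)) H) (h1 : H (k + 1) ≤ H j)
    (h2 : H (k + 2) ≤ H (k + 1)) {x : ℕ} (hjx : j ≤ x) (hx : x ≤ k + 2) :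
    (Q (k + 4)).real D / 18 * (H j - H x) ≤ (Q x).real D * (H j - H (k + 2)) := by
  have hharm : HarmonicOn p (Set.Ioo j (k + 3)) fun n => (Q n).real D := h.harmonicOn_real hD hDc
  obtain ⟨hk1, hk2⟩ := HarmonicOn.div_eighteen_le (k := k)
    (fun n hn => hharm n (by have := hn.1; have := hn.2; simp only [Set.mem_Ioo]; omega))
    (fun _ => measureReal_nonneg) hp
  have hnonneg : 0 ≤ (Q (k + 4)).real D / 18 := by positivity
  rw [mul_comm ((Q x).real D)]
  refine (hH.mul_const_sub hnonneg (H j)).le_of_Ioo h.isUpProb (HarmonicOn.superharmonicOn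
    (HarmonicOn.const_mul (fun n hn => hharm n ⟨hn.1, hn.2.trans (by omega)⟩) (H j - H (k + 2))))
    ?_ ?_ ?_ hjx hx
  · simp [h.real_eq_zero_of_subset_skipEvent hDj]
  · nlinarith
  · nlinarith

end IsWalkFamily

/-! ### Multiplicative barriers -/

section ProdOneSub

variable {ι : Type*} {u : ι → ℝ} {s : Finset ι}

theorem one_sub_sum_le_prod_one_sub (hu : ∀ i ∈ s, u i ∈ Set.Icc 0 1) :
    1 - ∑ i ∈ s, u i ≤ ∏ i ∈ s, (1 - u i) := by
  classical
  induction s using Finset.induction_on with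
  | empty => simp
  | insert a s ha ih =>
    obtain ⟨⟨ha0, ha1⟩, hs⟩ := (Finset.forall_mem_insert _ _ _).1 hu
    rw [Finset.sum_insert ha, Finset.prod_insert ha]
    have hsum : 0 ≤ ∑ i ∈ s, u i := Finset.sum_nonneg fun i hi => (hs i hi).1
    nlinarith [ih hs]

theorem prod_one_sub_mul_one_add_sum_le_one (hu : ∀ i ∈ s, u i ∈ Set.Icc 0 1) :
    (∏ i ∈ s, (1 - u i)) * (1 + ∑ i ∈ s, u i) ≤ 1 := by
  classical
  induction s using Finset.induction_on with
  | empty => simp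
  | insert a s ha ih =>
    obtain ⟨⟨ha0, _⟩, hs⟩ := (Finset.forall_mem_insert _ _ _).1 hu
    rw [Finset.sum_insert ha, Finset.prod_insert ha]
    have hsum : 0 ≤ ∑ i ∈ s, u i := Finset.sum_nonneg fun i hi => (hs i hi).1
    have hprod : 0 ≤ ∏ i ∈ s, (1 - u i) :=
      Finset.prod_nonneg fun i hi => sub_nonneg.2 (hs i hi).2
    calc (1 - u a) * (∏ i ∈ s, (1 - u i)) * (1 + (u a + ∑ i ∈ s, u i))
        = (∏ i ∈ s, (1 - u i)) * ((1 - u a) * (1 + (u a + ∑ i ∈ s, u i))) := by ring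
      _ ≤ (∏ i ∈ s, (1 - u i)) * (1 + ∑ i ∈ s, u i) := by
          gcongr
          nlinarith
      _ ≤ 1 := ih hs

end ProdOneSub

/-- The multiplicative barrier `∏ (1 - c * t i)` over `j < i ≤ n`, as a function of `n`. -/
noncomputable def barrier (t : ℕ → ℝ) (c : ℝ) (j n : ℕ) : ℝ := ∏ i ∈ Finset.Ioc j n, (1 - c * t i)

section Barrier

variable {p t : ℕ → ℝ} {c : ℝ} {j n : ℕ}

theorem barrier_self (t : ℕ → ℝ) (c : ℝ) (j : ℕ) : barrier t c j j = 1 := by simp [barrier]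

theorem barrier_succ (t : ℕ → ℝ) (c : ℝ) (hjn : j ≤ n) :
    barrier t c j (n + 1) = barrier t c j n * (1 - c * t (n + 1)) :=
  Finset.prod_Ioc_succ_top hjn _

theorem barrier_self_succ (t : ℕ → ℝ) (c : ℝ) (j : ℕ) :
    barrier t c j (j + 1) = 1 - c * t (j + 1) := by
  rw [barrier_succ t c le_rfl, barrier_self, one_mul]

theorem walkAvg_barrier_succ (p t : ℕ → ℝ) (c : ℝ) (hjn : j ≤ n) :
    walkAvg p (barrier t c j) (n + 1) = barrier t c j n * (p (n + 1) *
      ((1 - c * t (n + 1)) * (1 - c * t (n + 2)) * (1 - c * t (n + 3))) + (1 - p (n + 1))) := by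
  rw [walkAvg, show n + 1 + 2 = n + 2 + 1 from rfl, Nat.add_sub_cancel,
    barrier_succ t c (show j ≤ n + 2 by omega), barrier_succ t c (show j ≤ n + 1 by omega),
    barrier_succ t c hjn]
  ring

theorem superharmonicOn_barrier (hpos : ∀ n, 0 ≤ barrier t c j n)
    (hlocal : ∀ n, j < n → p n * ((1 - c * t n) * (1 - c * t (n + 1)) * (1 - c * t (n + 2))) +
      (1 - p n) ≤ 1 - c * t n) : SuperharmonicOn p (Set.Ioi j) (barrier t c j) := by
  rintro (_ | n) (hn : j < _)
  · omega
  · rw [walkAvg_barrier_succ p t c (by omega), barrier_succ t c (by omega)]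
    exact mul_le_mul_of_nonneg_left (hlocal (n + 1) hn) (hpos n)

theorem subharmonicOn_barrier (hpos : ∀ n, 0 ≤ barrier t c j n)
    (hlocal : ∀ n, j < n → 1 - c * t n ≤
      p n * ((1 - c * t n) * (1 - c * t (n + 1)) * (1 - c * t (n + 2))) + (1 - p n)) :
    SubharmonicOn p (Set.Ioi j) (barrier t c j) := by
  rintro (_ | n) (hn : j < _)
  · omega
  · rw [walkAvg_barrier_succ p t c (by omega), barrier_succ t c (by omega)]
    exact mul_le_mul_of_nonneg_left (hlocal (n + 1) hn) (hpos n)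

theorem barrier_nonneg (h : ∀ i, j < i → c * t i ≤ 1) (n : ℕ) : 0 ≤ barrier t c j n :=
  Finset.prod_nonneg fun i hi => sub_nonneg.2 (h i (Finset.mem_Ioc.1 hi).1)

theorem barrier_antitoneOn (h : ∀ i, j < i → c * t i ∈ Set.Icc 0 1) :
    AntitoneOn (barrier t c j) (Set.Ici j) :=
  antitoneOn_nat_Ici_of_succ_le fun n hn => by
    rw [barrier_succ t c hn]
    exact mul_le_of_le_one_right (barrier_nonneg (fun i hi => (h i hi).2) n)
      (sub_le_self _ (h (n + 1) (by omega)).1)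

end Barrier

-- With up-probability `(1 + 1 / n + t n) / 3`, one step multiplies `barrier t c j` by
-- `1 + c * (c - 1) * t n ^ 2` to leading order, so that any `c < 1` and any `c > 1` would do.
/-- A rate `t` for the walk beyond `N`: the barrier is superharmonic for the exponent `1 / 2` and
subharmonic for the exponent `2`. It governs the escape probabilities of the walk. -/
structure IsBarrierRate (p t : ℕ → ℝ) (N : ℕ) : Prop where
  mem_Ioc : ∀ n, N ≤ n → t n ∈ Set.Ioc 0 (1 / 4)
  upProb_mem : ∀ n, N ≤ n → p n ∈ Set.Icc (1 / 3 : ℝ) (1 / 2)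
  superharmonicOn : ∀ j, N ≤ j → SuperharmonicOn p (Set.Ioi j) (barrier t (1 / 2) j)
  subharmonicOn : ∀ j, N ≤ j → SubharmonicOn p (Set.Ioi j) (barrier t 2 j)

namespace IsBarrierRate

variable {p t : ℕ → ℝ} {N j k : ℕ} {Q : ℕ → Measure (ℕ → ℕ)} {D : Set (ℕ → ℕ)}

theorem mul_mem_Icc (hr : IsBarrierRate p t N) {c : ℝ} (hc : c ∈ Set.Icc 0 2) {i : ℕ}
    (hi : N ≤ i) : c * t i ∈ Set.Icc 0 1 := by
  obtain ⟨hpos, hle⟩ := hr.mem_Ioc i hi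
  exact ⟨mul_nonneg hc.1 hpos.le, by nlinarith [hc.2]⟩

theorem antitoneOn (hr : IsBarrierRate p t N) {c : ℝ} (hc : c ∈ Set.Icc 0 2) (hj : N ≤ j) :
    AntitoneOn (barrier t c j) (Set.Ici j) :=
  barrier_antitoneOn fun _ hi => hr.mul_mem_Icc hc (by omega)

theorem half_rate_le_escProb (hr : IsBarrierRate p t N) (h : IsWalkFamily p Q) (hj : N ≤ j) :
    t (j + 1) / 2 ≤ escProb Q j := by
  have hnonneg := barrier_nonneg (j := j) fun i hi =>
    (hr.mul_mem_Icc (c := 1 / 2) ⟨by norm_num, by norm_num⟩ (show N ≤ i by omega)).2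
  have hle := h.one_sub_skipProb_mul_le (hr.superharmonicOn j hj) (fun n _ => hnonneg n)
    (Nat.le_succ j)
  rw [barrier_self, barrier_self_succ] at hle
  unfold escProb
  linarith

theorem escProb_pos (hr : IsBarrierRate p t N) (h : IsWalkFamily p Q) (hj : N ≤ j) :
    0 < escProb Q j := by
  linarith [hr.half_rate_le_escProb h hj, (hr.mem_Ioc (j + 1) (by omega)).1]

theorem real_mul_sum_le (hr : IsBarrierRate p t N) (h : IsWalkFamily p Q) {M : ℝ}
    (hD : MeasurableSet D) (hDj : D ⊆ skipEvent j)
    (hDc : ∀ x ∈ Set.Ioo j k, consPath x ⁻¹' D = D)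
    (hDk : (Q k).real D ≤ M) (hDk1 : (Q (k + 1)).real D ≤ M) (hj : N ≤ j) (hjk : j < k) :
    (Q (j + 1)).real D * ∑ i ∈ Finset.Ioc j k, t i ≤
      M * t (j + 1) * (1 + 2 * ∑ i ∈ Finset.Ioc j k, t i) := by
  have hanti := hr.antitoneOn (c := 2) ⟨by norm_num, le_rfl⟩ hj
  have hle := h.real_mul_sub_le hD hDj hDc hDk hDk1 (fun n hn => hr.subharmonicOn j hj n hn.1)
    (hanti (Set.mem_Ici.2 le_rfl) (Set.mem_Ici.2 hjk.le) hjk.le)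
    (hanti (Set.mem_Ici.2 hjk.le) (Set.mem_Ici.2 (by omega)) (Nat.le_succ k))
    (Nat.le_succ j) (show j + 1 ≤ k + 1 by omega)
  have hprod := prod_one_sub_mul_one_add_sum_le_one (u := fun i => 2 * t i)
    (s := Finset.Ioc j k) fun i hi =>
      hr.mul_mem_Icc ⟨by norm_num, le_rfl⟩ (by have := (Finset.mem_Ioc.1 hi).1; omega)
  rw [← Finset.mul_sum, ← barrier] at hprod
  rw [barrier_self, barrier_self_succ] at hle
  have hsum : 0 ≤ ∑ i ∈ Finset.Ioc j k, t i := Finset.sum_nonneg fun i hi =>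
    (hr.mem_Ioc i (by have := (Finset.mem_Ioc.1 hi).1; omega)).1.le
  nlinarith [mul_le_mul_of_nonneg_right hle (show 0 ≤ 1 + 2 * ∑ i ∈ Finset.Ioc j k, t i by
    linarith), mul_le_mul_of_nonneg_left hprod (measureReal_nonneg (μ := Q (j + 1)) (s := D))]

theorem escProb_mul_sum_le (hr : IsBarrierRate p t N) (h : IsWalkFamily p Q) (hj : N ≤ j)
    (hjk : j < k) : escProb Q j * ∑ i ∈ Finset.Ioc j k, t i ≤
      t (j + 1) * (1 + 2 * ∑ i ∈ Finset.Ioc j k, t i) := by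
  rw [← one_mul (t (j + 1))]
  exact hr.real_mul_sum_le h (measurableSet_skipEvent j) subset_rfl
    (fun x hx => preimage_consPath_skipEvent (ne_of_gt hx.1)) (h.real_le_one _ _)
    (h.real_le_one _ _) hj hjk

theorem real_skip_inter_skip_mul_sum_le (hr : IsBarrierRate p t N) (h : IsWalkFamily p Q)
    (hj : N ≤ j) (hjk : j < k) :
    (Q (j + 1)).real (skipEvent j ∩ skipEvent k) * ∑ i ∈ Finset.Ioc j k, t i ≤
      escProb Q k * t (j + 1) * (1 + 2 * ∑ i ∈ Finset.Ioc j k, t i) := by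
  refine hr.real_mul_sum_le h ((measurableSet_skipEvent j).inter (measurableSet_skipEvent k))
    Set.inter_subset_left (fun x hx => ?_) ?_ (h.real_mono _ Set.inter_subset_right) hj hjk
  · rw [Set.preimage_inter, preimage_consPath_skipEvent (ne_of_gt hx.1),
      preimage_consPath_skipEvent (ne_of_lt hx.2)]
  · rw [h.real_eq_zero_of_subset_skipEvent Set.inter_subset_right]
    exact measureReal_nonneg

theorem div_eighteen_mul_rate_le (hr : IsBarrierRate p t N) (h : IsWalkFamily p Q)
    (hD : MeasurableSet D) (hDj : D ⊆ skipEvent j)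
    (hDc : ∀ x ∈ Set.Ioo j (k + 3), consPath x ⁻¹' D = D) (hj : N ≤ j) (hjk : j < k) :
    (Q (k + 4)).real D / 18 * t (j + 1) ≤
      (Q (j + 1)).real D * ∑ i ∈ Finset.Ioc j (k + 2), t i := by
  have hc : (1 / 2 : ℝ) ∈ Set.Icc 0 2 := ⟨by norm_num, by norm_num⟩
  have hanti := hr.antitoneOn hc hj
  have hle := h.div_eighteen_mul_sub_le hD hDj hDc hjk
    (fun n hn => hr.upProb_mem n (by have := hn.1; omega))
    (fun n hn => hr.superharmonicOn j hj n hn.1)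
    (hanti (Set.mem_Ici.2 le_rfl) (Set.mem_Ici.2 (by omega)) (by omega))
    (hanti (Set.mem_Ici.2 (by omega)) (Set.mem_Ici.2 (by omega)) (by omega))
    (Nat.le_succ j) (show j + 1 ≤ k + 2 by omega)
  have hprod := one_sub_sum_le_prod_one_sub (u := fun i => 1 / 2 * t i)
    (s := Finset.Ioc j (k + 2)) fun i hi =>
      hr.mul_mem_Icc hc (by have := (Finset.mem_Ioc.1 hi).1; omega)
  rw [← Finset.mul_sum, ← barrier] at hprod
  rw [barrier_self, barrier_self_succ] at hle
  nlinarith [mul_le_mul_of_nonneg_left hprod (measureReal_nonneg (μ := Q (j + 1)) (s := D))]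

end IsBarrierRate

/-! ### Asymptotics of the rate -/

/-- The slowly varying factor `(log log n) ^ (-β)` of the perturbation. The logarithm of a
logarithm is positive from `n = 3` on. -/
noncomputable def slowFactor (β : ℝ) (n : ℕ) : ℝ := Real.log (Real.log n) ^ (-β)

/-- The excess drift `(log log n) ^ (-β) / n` at the site `n`, which turns out to be the order of
the escape probability from `n`. -/
noncomputable def logRate (β : ℝ) (n : ℕ) : ℝ := slowFactor β n / n

theorem one_lt_log_natCast {n : ℕ} (hn : 3 ≤ n) : 1 < Real.log n := by
  have hn' : (3 : ℝ) ≤ n := by exact_mod_cast hn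
  rw [Real.lt_log_iff_exp_lt (by linarith)]
  linarith [Real.exp_one_lt_d9]

theorem log_log_natCast_pos {n : ℕ} (hn : 3 ≤ n) : 0 < Real.log (Real.log n) :=
  Real.log_pos (one_lt_log_natCast hn)

theorem slowFactor_pos (β : ℝ) {n : ℕ} (hn : 3 ≤ n) : 0 < slowFactor β n :=
  Real.rpow_pos_of_pos (log_log_natCast_pos hn) _

theorem logRate_pos (β : ℝ) {n : ℕ} (hn : 3 ≤ n) : 0 < logRate β n :=
  div_pos (slowFactor_pos β hn) (by exact_mod_cast (by omega : 0 < n))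

theorem upProb_perturbation_eq (β : ℝ) {n : ℕ} (hn : 4 ≤ n) :
    upProb (perturbation β) n = 1 / 3 * (1 + 1 / n + logRate β n) := by
  have hll := log_log_natCast_pos (show 3 ≤ n by omega)
  have hn0 : (n : ℝ) ≠ 0 := by positivity
  rw [upProb, if_neg (by omega), perturbation, if_neg (by omega), logRate, slowFactor,
    Real.rpow_neg hll.le]
  field_simp
  ring

theorem isUpProb_perturbation {β : ℝ} (hp : ∀ n, upProb (perturbation β) n ≤ 1) :
    IsUpProb (upProb (perturbation β)) where
  zero := by simp [upProb]
  pos n := by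
    obtain hn | hn := lt_or_ge n 4
    · interval_cases n <;> norm_num [upProb, perturbation]
    · rw [upProb_perturbation_eq β hn]
      have := logRate_pos β (show 3 ≤ n by omega)
      positivity
  le_one := hp

theorem log_sub_log_le_div {a b : ℝ} (ha : 0 < a) (hb : 0 < b) :
    Real.log b - Real.log a ≤ (b - a) / a := by
  rw [← Real.log_div hb.ne' ha.ne', sub_div, div_self ha.ne']
  exact Real.log_le_sub_one_of_pos (by positivity)

theorem log_log_sub_log_log_le_div {a b : ℝ} (ha : 1 < a) (hb : 1 < b) :
    Real.log (Real.log b) - Real.log (Real.log a) ≤ (b - a) / (a * Real.log a) := by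
  have hla := Real.log_pos ha
  calc Real.log (Real.log b) - Real.log (Real.log a)
      ≤ (Real.log b - Real.log a) / Real.log a := log_sub_log_le_div hla (Real.log_pos hb)
    _ ≤ (b - a) / a / Real.log a := by
        gcongr
        exact log_sub_log_le_div (by linarith) (by linarith)
    _ = (b - a) / (a * Real.log a) := div_div _ _ _

theorem tendsto_log_natCast : Tendsto (fun n : ℕ => Real.log n) atTop atTop :=
  Real.tendsto_log_atTop.comp tendsto_natCast_atTop_atTop

theorem tendsto_log_log_natCast : Tendsto (fun n : ℕ => Real.log (Real.log n)) atTop atTop :=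
  Real.tendsto_log_atTop.comp tendsto_log_natCast

theorem eventually_log_log_rpow_le (s : ℝ) :
    ∀ᶠ n : ℕ in atTop, Real.log (Real.log n) ^ s ≤ Real.log n ^ (1 / 2 : ℝ) := by
  have hlittle := (isLittleO_log_rpow_rpow_atTop s (show (0 : ℝ) < 1 / 2 by norm_num)).bound
    one_pos
  filter_upwards [tendsto_log_natCast.eventually hlittle, eventually_ge_atTop 3] with n hn hn3
  have hl := one_lt_log_natCast hn3
  have hll := log_log_natCast_pos hn3
  rwa [one_mul, Real.norm_of_nonneg (by positivity), Real.norm_of_nonneg (by positivity)] at hn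

theorem tendsto_slowFactor_mul_log (β : ℝ) :
    Tendsto (fun n : ℕ => slowFactor β n * Real.log n) atTop atTop := by
  have hsqrt : Tendsto (fun n : ℕ => Real.log n ^ (1 / 2 : ℝ)) atTop atTop :=
    (tendsto_rpow_atTop (by norm_num)).comp tendsto_log_natCast
  refine tendsto_atTop_mono' _ ?_ hsqrt
  filter_upwards [eventually_log_log_rpow_le β, eventually_ge_atTop 3] with n hn hn3
  have hl := one_lt_log_natCast hn3
  have hll := log_log_natCast_pos hn3
  rw [slowFactor, Real.rpow_neg hll.le, inv_mul_eq_div, le_div_iff₀ (by positivity)]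
  calc Real.log n ^ (1 / 2 : ℝ) * Real.log (Real.log n) ^ β
      ≤ Real.log n ^ (1 / 2 : ℝ) * Real.log n ^ (1 / 2 : ℝ) := by gcongr
    _ = Real.log n := by rw [← Real.rpow_add (by linarith)]; norm_num

theorem tendsto_logRate (β : ℝ) : Tendsto (logRate β) atTop (𝓝 0) := by
  have hlog : Tendsto (fun n : ℕ => Real.log n / n) atTop (𝓝 0) :=
    Real.isLittleO_log_id_atTop.tendsto_div_nhds_zero.comp tendsto_natCast_atTop_atTop
  refine squeeze_zero' ?_ ?_ hlog
  · filter_upwards [eventually_ge_atTop 3] with n hn using (logRate_pos β hn).le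
  · filter_upwards [eventually_log_log_rpow_le (-β), eventually_ge_atTop 3] with n hn hn3
    unfold logRate slowFactor
    gcongr
    exact hn.trans (Real.rpow_le_self_of_one_le (one_lt_log_natCast hn3).le (by norm_num))

theorem eventually_one_div_mul_log_le (β : ℝ) {κ : ℝ} (hκ : 0 < κ) :
    ∀ᶠ n : ℕ in atTop, 1 / (n * Real.log n) ≤ κ * logRate β n := by
  filter_upwards [(tendsto_slowFactor_mul_log β).eventually_ge_atTop (1 / κ),
    eventually_ge_atTop 3] with n hn hn3
  have hn0 : (0 : ℝ) < n := by positivity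
  have hl := one_lt_log_natCast hn3
  rw [div_le_iff₀ hκ] at hn
  rw [logRate, div_le_iff₀ (by positivity)]
  calc (1 : ℝ) ≤ slowFactor β n * Real.log n * κ := hn
    _ = κ * (slowFactor β n / n) * (n * Real.log n) := by field_simp

theorem eventually_one_div_sq_le (β : ℝ) {κ : ℝ} (hκ : 0 < κ) :
    ∀ᶠ n : ℕ in atTop, (1 / (n : ℝ)) ^ 2 ≤ κ * logRate β n := by
  filter_upwards [eventually_one_div_mul_log_le β hκ, eventually_ge_atTop 3] with n hn hn3
  have hl := one_lt_log_natCast hn3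
  refine le_trans ?_ hn
  rw [div_pow, one_pow, sq]
  gcongr
  exact Real.log_le_self n.cast_nonneg

theorem abs_rpow_sub_one_le {u s : ℝ} (hu : 1 ≤ u) (hs : |s| * (u - 1) ≤ 1) :
    |u ^ s - 1| ≤ 2 * |s| * (u - 1) := by
  have hu0 : 0 < u := by linarith
  have hexp : |Real.log u * s| ≤ |s| * (u - 1) := by
    rw [abs_mul, abs_of_nonneg (Real.log_nonneg hu), mul_comm]
    gcongr
    exact Real.log_le_sub_one_of_pos hu0
  rw [Real.rpow_def_of_pos hu0]
  linarith [Real.abs_exp_sub_one_le (hexp.trans hs)]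

theorem slowFactor_eq_rpow_mul (β : ℝ) {j k : ℕ} (hj : 3 ≤ j) (hk : 3 ≤ k) :
    slowFactor β k = (Real.log (Real.log k) / Real.log (Real.log j)) ^ (-β) * slowFactor β j := by
  have hlj := log_log_natCast_pos hj
  rw [Real.div_rpow (log_log_natCast_pos hk).le hlj.le, slowFactor, slowFactor,
    div_mul_cancel₀ _ (Real.rpow_pos_of_pos hlj _).ne']

theorem log_log_natCast_le {j k : ℕ} (hj : 3 ≤ j) (hjk : j ≤ k) :
    Real.log (Real.log j) ≤ Real.log (Real.log k) := by
  have hlj := one_lt_log_natCast hj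
  gcongr

theorem eventually_abs_slowFactor_add_sub_le (β : ℝ) (m : ℕ) :
    ∀ᶠ n : ℕ in atTop, |slowFactor β (n + m) - slowFactor β n| ≤
      2 * |β| * (m / (n * Real.log n)) * slowFactor β n := by
  have hmul : Tendsto (fun n : ℕ => (n : ℝ) * Real.log n) atTop atTop :=
    tendsto_natCast_atTop_atTop.atTop_mul_atTop₀ tendsto_log_natCast
  filter_upwards [hmul.eventually_ge_atTop (|β| * m), eventually_ge_atTop 3,
    tendsto_log_log_natCast.eventually_ge_atTop 1] with n hn hn3 hll
  have hl := one_lt_log_natCast hn3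
  have hn0 : (3 : ℝ) ≤ n := by exact_mod_cast hn3
  set u := Real.log (Real.log (n + m : ℕ)) / Real.log (Real.log n) with hu
  have hu_one : 1 ≤ u := (one_le_div (by linarith)).2 (log_log_natCast_le hn3 (by omega))
  have hu_sub : u - 1 ≤ m / (n * Real.log n) := by
    rw [hu, div_sub_one (by linarith)]
    refine (div_le_self (sub_nonneg.2 (log_log_natCast_le hn3 (by omega))) hll).trans ?_
    have := log_log_sub_log_log_le_div (show (1 : ℝ) < n by linarith)
      (show (1 : ℝ) < (n + m : ℕ) by push_cast; linarith)
    rwa [show ((n + m : ℕ) : ℝ) - n = m by push_cast; ring] at this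
  have hsmall : |-β| * (u - 1) ≤ 1 := by
    rw [abs_neg]
    calc |β| * (u - 1) ≤ |β| * (m / (n * Real.log n)) := by gcongr
      _ = |β| * m / (n * Real.log n) := (mul_div_assoc _ _ _).symm
      _ ≤ 1 := (div_le_one (by positivity)).2 hn
  rw [slowFactor_eq_rpow_mul β hn3 (show 3 ≤ n + m by omega), ← sub_one_mul, abs_mul,
    abs_of_pos (slowFactor_pos β hn3), ← hu]
  have := slowFactor_pos β hn3
  gcongr
  refine (abs_rpow_sub_one_le hu_one hsmall).trans ?_
  rw [abs_neg]
  gcongr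

theorem eventually_abs_logRate_add_sub_le (β : ℝ) (m : ℕ) {κ : ℝ} (hκ : 0 < κ) :
    ∀ᶠ n : ℕ in atTop,
      |logRate β (n + m) - logRate β n * (1 - m * (1 / n))| ≤ κ * logRate β n ^ 2 := by
  filter_upwards [eventually_abs_slowFactor_add_sub_le β m, eventually_ge_atTop 3,
    eventually_one_div_mul_log_le β (show 0 < κ / 2 / (2 * |β| * m + 1) by positivity),
    eventually_one_div_sq_le β (show 0 < κ / 2 / (m ^ 2 + 1) by positivity)]
    with n hslow hn3 hlog hsq
  have hl := one_lt_log_natCast hn3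
  have ht := logRate_pos β hn3
  have hS := slowFactor_pos β hn3
  have hsplit : logRate β (n + m) - logRate β n * (1 - m * (1 / n)) =
      (slowFactor β (n + m) - slowFactor β n) / (n + m) +
        logRate β n * (m ^ 2 * (1 / n * (1 / (n + m)))) := by
    unfold logRate
    push_cast
    field_simp
    ring
  have hincr : |(slowFactor β (n + m) - slowFactor β n) / (n + m)| ≤ κ / 2 * logRate β n ^ 2 := by
    rw [abs_div, abs_of_pos (show (0 : ℝ) < n + m by positivity)]
    calc |slowFactor β (n + m) - slowFactor β n| / (n + m)
        ≤ 2 * |β| * (m / (n * Real.log n)) * slowFactor β n / n := by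
          gcongr
          linarith [m.cast_nonneg (α := ℝ)]
      _ = 2 * |β| * m * (1 / (n * Real.log n)) * logRate β n := by unfold logRate; ring
      _ ≤ (2 * |β| * m + 1) * (κ / 2 / (2 * |β| * m + 1) * logRate β n) * logRate β n := by
          gcongr
          linarith
      _ = κ / 2 * logRate β n ^ 2 := by field_simp
  have hcurv : |logRate β n * (m ^ 2 * (1 / n * (1 / (n + m))))| ≤ κ / 2 * logRate β n ^ 2 := by
    rw [abs_of_nonneg (by positivity)]
    calc logRate β n * (m ^ 2 * (1 / n * (1 / (n + m))))
        ≤ logRate β n * ((m ^ 2 + 1) * (1 / n * (1 / n))) := by gcongr <;> linarith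
      _ ≤ logRate β n * ((m ^ 2 + 1) * (κ / 2 / (m ^ 2 + 1) * logRate β n)) := by
          rw [← sq]
          gcongr
      _ = κ / 2 * logRate β n ^ 2 := by field_simp
  rw [hsplit]
  linarith [abs_add_le ((slowFactor β (n + m) - slowFactor β n) / (n + m))
    (logRate β n * (m ^ 2 * (1 / n * (1 / (n + m)))))]

section OneStep

variable {t₀ t₁ t₂ s : ℝ}

theorem upProb_mul_prod_add_le_of_abs_sub_le (ht : t₀ ∈ Set.Ioc 0 (1 / 100))
    (hs : s ∈ Set.Icc 0 (1 / 100)) (hst : s ^ 2 ≤ 1 / 100 * t₀)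
    (h₁ : |t₁ - t₀ * (1 - s)| ≤ 1 / 100 * t₀ ^ 2)
    (h₂ : |t₂ - t₀ * (1 - 2 * s)| ≤ 1 / 100 * t₀ ^ 2) :
    1 / 3 * (1 + s + t₀) * ((1 - 1 / 2 * t₀) * (1 - 1 / 2 * t₁) * (1 - 1 / 2 * t₂)) +
      (1 - 1 / 3 * (1 + s + t₀)) ≤ 1 - 1 / 2 * t₀ := by
  obtain ⟨ht0, ht1⟩ := ht
  obtain ⟨hs0, hs1⟩ := hs
  rw [abs_le] at h₁ h₂
  have hle₁ : t₁ ≤ 101 / 100 * t₀ := by nlinarith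
  have hle₂ : t₂ ≤ 101 / 100 * t₀ := by nlinarith
  have hpos₁ : 0 ≤ t₁ := by nlinarith
  have hpos₂ : 0 ≤ t₂ := by nlinarith
  have hpairs : t₀ * t₁ + t₀ * t₂ + t₁ * t₂ ≤ 31 / 10 * t₀ ^ 2 := by
    nlinarith [mul_le_mul hle₁ hle₂ hpos₂ (by linarith : (0 : ℝ) ≤ 101 / 100 * t₀)]
  have htriple : 0 ≤ t₀ * t₁ * t₂ := by positivity
  have hsum : t₀ * (3 - 3 * s - t₀ / 50) ≤ t₀ + t₁ + t₂ := by linarith [h₁.1, h₂.1]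
  have hprod : t₀ / 2 * (3 - 3 * s - 157 / 100 * t₀) ≤
      1 - (1 - 1 / 2 * t₀) * (1 - 1 / 2 * t₁) * (1 - 1 / 2 * t₂) := by
    linarith [hsum, hpairs, htriple]
  have hdrift : 1 ≤ 1 / 3 * (1 + s + t₀) * (3 - 3 * s - 157 / 100 * t₀) := by
    nlinarith [mul_nonneg hs0 ht0.le]
  linarith [mul_le_mul_of_nonneg_left hprod (show 0 ≤ 1 / 3 * (1 + s + t₀) by positivity),
    mul_le_mul_of_nonneg_left hdrift (show 0 ≤ 1 / 2 * t₀ by positivity)]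

theorem le_upProb_mul_prod_add_of_abs_sub_le (ht : t₀ ∈ Set.Ioc 0 (1 / 100))
    (hs : s ∈ Set.Icc 0 (1 / 100)) (h₁ : |t₁ - t₀ * (1 - s)| ≤ 1 / 100 * t₀ ^ 2)
    (h₂ : |t₂ - t₀ * (1 - 2 * s)| ≤ 1 / 100 * t₀ ^ 2) :
    1 - 2 * t₀ ≤ 1 / 3 * (1 + s + t₀) * ((1 - 2 * t₀) * (1 - 2 * t₁) * (1 - 2 * t₂)) +
      (1 - 1 / 3 * (1 + s + t₀)) := by
  obtain ⟨ht0, ht1⟩ := ht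
  obtain ⟨hs0, hs1⟩ := hs
  rw [abs_le] at h₁ h₂
  have hle₁ : t₁ ≤ 101 / 100 * t₀ := by nlinarith
  have hle₂ : t₂ ≤ 101 / 100 * t₀ := by nlinarith
  have hge₁ : 97 / 100 * t₀ ≤ t₁ := by nlinarith
  have hge₂ : 97 / 100 * t₀ ≤ t₂ := by nlinarith
  have hge₁₂ : (97 / 100 * t₀) * (97 / 100 * t₀) ≤ t₁ * t₂ :=
    mul_le_mul hge₁ hge₂ (by positivity) (by linarith)
  have hle₁₂ : t₁ * t₂ ≤ (101 / 100 * t₀) * (101 / 100 * t₀) :=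
    mul_le_mul hle₁ hle₂ (by linarith) (by linarith)
  have hpairs : 28 / 10 * t₀ ^ 2 ≤ t₀ * t₁ + t₀ * t₂ + t₁ * t₂ := by nlinarith
  have htriple : t₀ * t₁ * t₂ ≤ 2 / 100 * t₀ ^ 2 := by nlinarith [mul_pos ht0 ht0]
  have hsum : t₀ + t₁ + t₂ ≤ t₀ * (3 - 3 * s + t₀ / 50) := by linarith [h₁.2, h₂.2]
  have hprod : 1 - (1 - 2 * t₀) * (1 - 2 * t₁) * (1 - 2 * t₂) ≤
      2 * t₀ * (3 - 3 * s - 5 * t₀) := by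
    linarith [hsum, hpairs, htriple, sq_nonneg t₀]
  have hdrift : 1 / 3 * (1 + s + t₀) * (3 - 3 * s - 5 * t₀) ≤ 1 := by
    nlinarith [mul_nonneg hs0 ht0.le, sq_nonneg s, sq_nonneg t₀]
  linarith [mul_le_mul_of_nonneg_left hprod (show 0 ≤ 1 / 3 * (1 + s + t₀) by positivity),
    mul_le_mul_of_nonneg_left hdrift (show 0 ≤ 2 * t₀ by positivity)]

end OneStep

theorem exists_isBarrierRate (β : ℝ) :
    ∃ N, IsBarrierRate (upProb (perturbation β)) (logRate β) N := by
  have hκ : (0 : ℝ) < 1 / 100 := by norm_num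
  obtain ⟨N, hN⟩ := eventually_atTop.1 (((tendsto_logRate β).eventually_le_const hκ).and
    (((tendsto_one_div_atTop_nhds_zero_nat (𝕜 := ℝ)).eventually_le_const hκ).and
    ((eventually_ge_atTop 4).and ((eventually_one_div_sq_le β hκ).and
    ((eventually_abs_logRate_add_sub_le β 1 hκ).and
    (eventually_abs_logRate_add_sub_le β 2 hκ))))))
  have hrate : ∀ n, N ≤ n → logRate β n ∈ Set.Ioc 0 (1 / 100) := fun n hn =>
    ⟨logRate_pos β (by have := (hN n hn).2.2.1; omega), (hN n hn).1⟩
  have hinv : ∀ n, N ≤ n → (1 / n : ℝ) ∈ Set.Icc 0 (1 / 100) := fun n hn =>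
    ⟨by positivity, (hN n hn).2.1⟩
  refine ⟨N, fun n hn => ⟨(hrate n hn).1, (hrate n hn).2.trans (by norm_num)⟩,
    fun n hn => ?_, fun j hj => superharmonicOn_barrier (barrier_nonneg fun i hi => ?_) ?_,
    fun j hj => subharmonicOn_barrier (barrier_nonneg fun i hi => ?_) ?_⟩
  · rw [upProb_perturbation_eq β (hN n hn).2.2.1]
    constructor <;> linarith [(hrate n hn).1, (hrate n hn).2, (hinv n hn).1, (hinv n hn).2]
  · linarith [(hrate i (by omega)).2]
  · intro n hn
    obtain ⟨-, -, hn4, hsq, hone, htwo⟩ := hN n (by omega)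
    rw [upProb_perturbation_eq β hn4]
    exact upProb_mul_prod_add_le_of_abs_sub_le (hrate n (by omega)) (hinv n (by omega)) hsq
      (by simpa using hone) (by simpa using htwo)
  · linarith [(hrate i (by omega)).2]
  · intro n hn
    obtain ⟨-, -, hn4, -, hone, htwo⟩ := hN n (by omega)
    rw [upProb_perturbation_eq β hn4]
    exact le_upProb_mul_prod_add_of_abs_sub_le (hrate n (by omega)) (hinv n (by omega))
      (by simpa using hone) (by simpa using htwo)

theorem slowFactor_comparable_of_log_log_le {β : ℝ} {j k : ℕ} (hj : 3 ≤ j) (hjk : j ≤ k)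
    (hkj : Real.log (Real.log k) ≤ 2 * Real.log (Real.log j)) :
    slowFactor β k ≤ 2 ^ |β| * slowFactor β j ∧ slowFactor β j ≤ 2 ^ |β| * slowFactor β k := by
  have hll := log_log_natCast_pos hj
  set u := Real.log (Real.log k) / Real.log (Real.log j) with hu
  have hu1 : 1 ≤ u := (one_le_div hll).2 (log_log_natCast_le hj hjk)
  have hu2 : u ≤ 2 := (div_le_iff₀ hll).2 hkj
  have hpow : ∀ s : ℝ, |s| = |β| → u ^ s ≤ 2 ^ |β| := fun s hs => by
    calc u ^ s ≤ u ^ |s| := Real.rpow_le_rpow_of_exponent_le hu1 (le_abs_self s)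
      _ ≤ 2 ^ |β| := hs ▸ Real.rpow_le_rpow (by linarith) hu2 (abs_nonneg s)
  have hk := slowFactor_eq_rpow_mul β hj (show 3 ≤ k by omega)
  rw [← hu] at hk
  have hj' : slowFactor β j = u ^ β * slowFactor β k := by
    rw [hk, ← mul_assoc, ← Real.rpow_add (by linarith), add_neg_cancel, Real.rpow_zero, one_mul]
  constructor
  · rw [hk]
    exact mul_le_mul_of_nonneg_right (hpow _ (abs_neg β)) (slowFactor_pos β hj).le
  · nth_rewrite 1 [hj']
    exact mul_le_mul_of_nonneg_right (hpow _ rfl) (slowFactor_pos β (by omega)).le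

theorem exists_slowFactor_comparable (β : ℝ) : ∃ C : ℝ, 1 ≤ C ∧ ∀ᶠ j : ℕ in atTop,
    ∀ k ∈ Set.Icc j (j ^ 2),
      slowFactor β k ≤ C * slowFactor β j ∧ slowFactor β j ≤ C * slowFactor β k := by
  refine ⟨2 ^ |β|, Real.one_le_rpow (by norm_num) (abs_nonneg β), ?_⟩
  filter_upwards [eventually_ge_atTop 3, tendsto_log_log_natCast.eventually_ge_atTop 1]
    with j hj hll k hk
  refine slowFactor_comparable_of_log_log_le hj hk.1 ?_
  have hlj := one_lt_log_natCast hj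
  have hlk := one_lt_log_natCast (show 3 ≤ k from hj.trans hk.1)
  have hlog : Real.log k ≤ 2 * Real.log j := by
    rw [← Nat.cast_ofNat, ← Real.log_pow]
    exact Real.log_le_log (by exact_mod_cast (by linarith [hk.1] : 0 < k))
      (by exact_mod_cast hk.2)
  calc Real.log (Real.log k) ≤ Real.log (2 * Real.log j) := by gcongr
    _ = Real.log 2 + Real.log (Real.log j) := Real.log_mul (by norm_num) (by linarith)
    _ ≤ 2 * Real.log (Real.log j) := by linarith [Real.log_two_lt_d9]

theorem log_sub_log_le_sum_Ioc {a b : ℕ} (hab : a ≤ b) :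
    Real.log (b + 1) - Real.log (a + 1) ≤ ∑ i ∈ Finset.Ioc a b, 1 / (i : ℝ) := by
  induction b, hab using Nat.le_induction with
  | base => simp
  | succ n hn ih =>
    rw [Finset.sum_Ioc_succ_top hn]
    have := log_sub_log_le_div (show (0 : ℝ) < n + 1 by positivity)
      (show (0 : ℝ) < n + 1 + 1 by positivity)
    rw [add_sub_cancel_left] at this
    push_cast
    linarith

theorem one_div_add_one_le_log_sub_log {y : ℝ} (hy : 0 < y) :
    1 / (y + 1) ≤ Real.log (y + 1) - Real.log y := by
  have := log_sub_log_le_div (show 0 < y + 1 by linarith) hy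
  rw [sub_add_cancel_left, neg_div] at this
  linarith

theorem sum_Ioc_le_log_sub_log {a b : ℕ} (ha : 0 < a) (hab : a ≤ b) :
    ∑ i ∈ Finset.Ioc a b, 1 / (i : ℝ) ≤ Real.log b - Real.log a := by
  induction b, hab using Nat.le_induction with
  | base => simp
  | succ n hn ih =>
    rw [Finset.sum_Ioc_succ_top hn]
    have := one_div_add_one_le_log_sub_log (show (0 : ℝ) < n by exact_mod_cast ha.trans_le hn)
    push_cast
    linarith

theorem half_log_le_sum_Ioc_sq {j : ℕ} (hj : 2 ≤ j) (hlog : 2 ≤ Real.log j) :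
    1 / 2 * Real.log j ≤ ∑ i ∈ Finset.Ioc j (j ^ 2), 1 / (i : ℝ) := by
  have hj' : (2 : ℝ) ≤ j := by exact_mod_cast hj
  have hsum := log_sub_log_le_sum_Ioc (show j ≤ j ^ 2 by nlinarith)
  have hsq : 2 * Real.log j ≤ Real.log ((j ^ 2 : ℕ) + 1) := by
    rw [← Nat.cast_ofNat, ← Real.log_pow]
    exact Real.log_le_log (by positivity) (by push_cast; linarith)
  have hsucc : Real.log (j + 1) ≤ Real.log j + 1 / 2 := by
    have := log_sub_log_le_div (show (0 : ℝ) < j by linarith) (show (0 : ℝ) < j + 1 by linarith)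
    rw [add_sub_cancel_left] at this
    linarith [one_div_le_one_div_of_le two_pos hj']
  linarith

theorem tendsto_sum_logRate (β : ℝ) :
    Tendsto (fun j : ℕ => ∑ i ∈ Finset.Ioc j (j ^ 2), logRate β i) atTop atTop := by
  obtain ⟨C, hC, hcomp⟩ := exists_slowFactor_comparable β
  refine tendsto_atTop_mono' _ ?_ ((tendsto_slowFactor_mul_log β).const_mul_atTop
    (show 0 < 1 / (2 * C) by positivity))
  filter_upwards [hcomp, eventually_ge_atTop 3, tendsto_log_natCast.eventually_ge_atTop 2]
    with j hj hj3 hlog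
  have hS := slowFactor_pos β hj3
  calc 1 / (2 * C) * (slowFactor β j * Real.log j)
      = 1 / C * slowFactor β j * (1 / 2 * Real.log j) := by field_simp
    _ ≤ 1 / C * slowFactor β j * ∑ i ∈ Finset.Ioc j (j ^ 2), 1 / (i : ℝ) := by
        gcongr
        exact half_log_le_sum_Ioc_sq (by omega) hlog
    _ = ∑ i ∈ Finset.Ioc j (j ^ 2), 1 / C * slowFactor β j / (i : ℝ) := by
        simp only [Finset.mul_sum, mul_one_div]
    _ ≤ ∑ i ∈ Finset.Ioc j (j ^ 2), logRate β i := by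
        refine Finset.sum_le_sum fun i hi => ?_
        unfold logRate
        gcongr
        rw [one_div, inv_mul_le_iff₀ (by linarith)]
        exact (hj i (Set.Ioc_subset_Icc_self (Finset.mem_Ioc.1 hi))).2

theorem exists_logRate_le_mul (β : ℝ) : ∃ C : ℝ, 1 ≤ C ∧ ∀ᶠ j : ℕ in atTop,
    ∀ k ∈ Set.Icc j (j ^ 2), logRate β k ≤ C * logRate β j := by
  obtain ⟨C, hC, hcomp⟩ := exists_slowFactor_comparable β
  refine ⟨C, hC, ?_⟩
  filter_upwards [hcomp, eventually_ge_atTop 3] with j hj hj3 k hk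
  have hS := slowFactor_pos β hj3
  calc logRate β k ≤ C * slowFactor β j / k := by
        unfold logRate
        gcongr
        exact (hj k hk).1
    _ ≤ C * slowFactor β j / j := by
        gcongr
        exact hk.1
    _ = C * logRate β j := mul_div_assoc _ _ _

theorem exists_logRate_le_mul_of_le_two_mul (β : ℝ) : ∃ C : ℝ, 1 ≤ C ∧ ∀ᶠ j : ℕ in atTop,
    ∀ k ∈ Set.Icc j (2 * j), logRate β j ≤ C * logRate β k := by
  obtain ⟨C, hC, hcomp⟩ := exists_slowFactor_comparable β
  refine ⟨2 * C, by linarith, ?_⟩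
  filter_upwards [hcomp, eventually_ge_atTop 3] with j hj hj3 k hk
  have hj0 : (0 : ℝ) < j := by exact_mod_cast (by omega : 0 < j)
  have hk0 : (0 : ℝ) < k := hj0.trans_le (by exact_mod_cast hk.1)
  have hkj : (k : ℝ) ≤ 2 * j := by exact_mod_cast hk.2
  have hS := slowFactor_pos β (hj3.trans hk.1)
  calc logRate β j ≤ C * slowFactor β k / j := by
        unfold logRate
        gcongr
        exact (hj k ⟨hk.1, hk.2.trans (by nlinarith)⟩).2
    _ ≤ C * slowFactor β k / (k / 2) := by
        gcongr
        linarith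
    _ = 2 * C * logRate β k := by
        unfold logRate
        field_simp

theorem eventually_logRate_succ_mem (β : ℝ) :
    ∀ᶠ j : ℕ in atTop, logRate β (j + 1) ∈ Set.Icc (logRate β j / 2) (2 * logRate β j) := by
  filter_upwards [eventually_abs_logRate_add_sub_le β 1 (show (0 : ℝ) < 1 / 4 by norm_num),
    (tendsto_logRate β).eventually_le_const one_pos, eventually_ge_atTop 4] with j hclose hle hj
  have hpos := logRate_pos β (show 3 ≤ j by omega)
  have hinv : (1 : ℝ) / j ≤ 1 / 4 := by
    gcongr
    exact_mod_cast hj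
  have hinv0 : (0 : ℝ) ≤ 1 / j := by positivity
  obtain ⟨hlower, hupper⟩ := abs_le.1 hclose
  push_cast at hlower hupper
  constructor <;> nlinarith

theorem eventually_escProb_mem {β : ℝ} {Q : ℕ → Measure (ℕ → ℕ)}
    (h : IsWalkFamily (upProb (perturbation β)) Q) :
    ∀ᶠ j in atTop, escProb Q j ∈ Set.Icc (logRate β j / 4) (6 * logRate β j) := by
  obtain ⟨N, hr⟩ := exists_isBarrierRate β
  filter_upwards [eventually_ge_atTop N, eventually_ge_atTop 2, eventually_logRate_succ_mem β,
    (tendsto_sum_logRate β).eventually_ge_atTop 1] with j hj hj2 hsucc hsum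
  have hlower := hr.half_rate_le_escProb h hj
  have hupper := hr.escProb_mul_sum_le h hj (show j < j ^ 2 by nlinarith)
  have hesc : escProb Q j ≤ 3 * logRate β (j + 1) := by nlinarith
  constructor <;> linarith [hsucc.1, hsucc.2]

/-! ### Finitely many skipped points for `1 < β` -/

/-- The event that `k` is the last skipped site below `K`. -/
def lastSkipEvent (k K : ℕ) : Set (ℕ → ℕ) := skipEvent k ∩ ⋂ i ∈ Finset.Ioo k K, (skipEvent i)ᶜ

theorem lastSkipEvent_subset (k K : ℕ) : lastSkipEvent k K ⊆ skipEvent k := Set.inter_subset_left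

theorem measurableSet_lastSkipEvent (k K : ℕ) : MeasurableSet (lastSkipEvent k K) :=
  (measurableSet_skipEvent k).inter
    (Finset.measurableSet_biInter _ fun i _ => (measurableSet_skipEvent i).compl)

theorem preimage_consPath_lastSkipEvent {x k : ℕ} (K : ℕ) (hx : x < k) :
    consPath x ⁻¹' lastSkipEvent k K = lastSkipEvent k K := by
  unfold lastSkipEvent
  rw [Set.preimage_inter, preimage_consPath_skipEvent hx.ne, Set.preimage_iInter₂]
  congr 1
  refine Set.iInter₂_congr fun i hi => ?_
  rw [Set.preimage_compl, preimage_consPath_skipEvent (hx.trans (Finset.mem_Ioo.1 hi).1).ne]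

theorem pairwiseDisjoint_lastSkipEvent (K : ℕ) :
    (Set.Iio K).PairwiseDisjoint fun k => lastSkipEvent k K := by
  have hlt : ∀ {k l}, k < l → l < K → Disjoint (lastSkipEvent k K) (lastSkipEvent l K) :=
    fun hkl hl => Set.disjoint_left.2 fun _ hk hl' =>
      Set.mem_iInter₂.1 hk.2 _ (Finset.mem_Ioo.2 ⟨hkl, hl⟩) hl'.1
  intro k hk l hl hkl
  obtain hkl | hkl := hkl.lt_or_gt
  exacts [hlt hkl hl, (hlt hkl hk).symm]

theorem biUnion_skipEvent_subset (a K : ℕ) :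
    ⋃ k ∈ Finset.Ico a K, skipEvent k ⊆ ⋃ k ∈ Finset.Ico a K, lastSkipEvent k K := by
  classical
  intro ω hω
  simp only [Set.mem_iUnion, exists_prop] at hω ⊢
  obtain ⟨l, hl, hωl⟩ := hω
  obtain ⟨k, hk, hmax⟩ := ((Finset.Ico a K).filter (ω ∈ skipEvent ·)).exists_max_image id
    ⟨l, Finset.mem_filter.2 ⟨hl, hωl⟩⟩
  obtain ⟨hkK, hωk⟩ := Finset.mem_filter.1 hk
  refine ⟨k, hkK, hωk, Set.mem_iInter₂.2 fun i hi hωi => ?_⟩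
  rw [Finset.mem_Ioo] at hi
  rw [Finset.mem_Ico] at hkK
  exact hi.1.not_ge
    (hmax i (Finset.mem_filter.2 ⟨Finset.mem_Ico.2 ⟨by omega, hi.2⟩, hωi⟩))

theorem IsBarrierRate.real_le_mul_real_skipEvent_inter {p t : ℕ → ℝ} {N : ℕ}
    {Q : ℕ → Measure (ℕ → ℕ)} (hr : IsBarrierRate p t N) (h : IsWalkFamily p Q)
    {D : Set (ℕ → ℕ)} {x j k : ℕ} {M : ℝ} (hD : MeasurableSet D) (hDk : D ⊆ skipEvent k)
    (hDc : ∀ y < k, consPath y ⁻¹' D = D) (hx : x < j) (hj : N + 3 ≤ j) (hjk : j + 3 < k)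
    (hM : ∑ i ∈ Finset.Ioc j (k - 1), t i ≤ M * t (j + 1)) :
    (Q x).real D ≤ 324 * M * (Q x).real (skipEvent j ∩ D) := by
  have hDm : MeasurableSet (skipEvent j ∩ D) := (measurableSet_skipEvent j).inter hD
  have hinv : ∀ y, y ≠ j → y < k → consPath y ⁻¹' (skipEvent j ∩ D) = skipEvent j ∩ D :=
    fun y hyj hyk => by rw [Set.preimage_inter, preimage_consPath_skipEvent hyj, hDc y hyk]
  have hpos := (hr.mem_Ioc (j + 1) (by omega)).1
  have hfromk : (Q x).real D ≤ (Q (k + 1)).real D :=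
    h.real_le_real_succ hD hDk hDc (by omega)
  have habove : (Q (k + 1)).real D ≤ (Q (k + 1)).real (skipEvent j ∩ D) := by
    have := h.isProbabilityMeasure (k + 1)
    refine ENNReal.toReal_mono (measure_ne_top _ _) (measure_mono_ae ?_)
    filter_upwards [h.ae_lt_of_mem_skipEvent (Nat.lt_succ_self k)] with ω hω hωD
    exact ⟨fun n => (show j < k by omega).trans (hω (hDk hωD) n) |>.ne', hωD⟩
  have hclimb : (Q (k + 1)).real (skipEvent j ∩ D) ≤
      18 * M * (Q (j + 1)).real (skipEvent j ∩ D) := by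
    obtain ⟨l, rfl⟩ : ∃ l, k = l + 3 := ⟨k - 3, by omega⟩
    have hle := hr.div_eighteen_mul_rate_le h hDm Set.inter_subset_left
      (fun y hy => hinv y hy.1.ne' hy.2) (show N ≤ j by omega) (show j < l by omega)
    have := hle.trans (mul_le_mul_of_nonneg_left hM measureReal_nonneg)
    have := le_of_mul_le_mul_right (this.trans_eq (mul_assoc _ _ _).symm) hpos
    linarith
  have hstart : (Q (j + 1)).real (skipEvent j ∩ D) / 18 ≤ (Q x).real (skipEvent j ∩ D) := by
    obtain ⟨i, rfl⟩ : ∃ i, j = i + 3 := ⟨j - 3, by omega⟩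
    exact h.div_eighteen_le_real hDm (fun y hy => hinv y (by omega) (by omega))
      (fun n hn => hr.upProb_mem n (by have := hn.1; omega)) (by omega)
  have hM0 : 0 ≤ M := nonneg_of_mul_nonneg_left (hM.trans' <| Finset.sum_nonneg fun i hi =>
    (hr.mem_Ioc i (by have := (Finset.mem_Ioc.1 hi).1; omega)).1.le) hpos
  calc (Q x).real D ≤ 18 * M * (Q (j + 1)).real (skipEvent j ∩ D) :=
        hfromk.trans (habove.trans hclimb)
    _ ≤ 18 * M * (18 * (Q x).real (skipEvent j ∩ D)) := by
        gcongr
        linarith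
    _ = 324 * M * (Q x).real (skipEvent j ∩ D) := by ring

theorem mul_half_log_le_mul_sum_Ico {f : ℕ → ℝ} {g C : ℝ} {a k : ℕ} (hg : 0 ≤ g) (hC : 0 ≤ C)
    (hf : ∀ j, 0 ≤ f j) (hfg : ∀ d ∈ Finset.Ioc 3 a, g ≤ C * d * f (k - d))
    (hlog : 2 * Real.log 4 ≤ Real.log a) (ha : 3 ≤ a) (hk : 2 * a ≤ k) :
    g * (1 / 2 * Real.log a) ≤ C * ∑ j ∈ Finset.Ico a k, f j := by
  have hharm : 1 / 2 * Real.log a ≤ ∑ d ∈ Finset.Ioc 3 a, 1 / (d : ℝ) := by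
    have hsum := log_sub_log_le_sum_Ioc ha
    have hsucc : Real.log a ≤ Real.log (a + 1) :=
      Real.log_le_log (by positivity) (by linarith)
    norm_num at hsum ⊢
    linarith
  have hinj : Set.InjOn (k - ·) (Finset.Ioc 3 a : Set ℕ) := fun d hd e he hde => by
    simp only [Finset.coe_Ioc, Set.mem_Ioc] at hd he hde
    omega
  calc g * (1 / 2 * Real.log a) ≤ g * ∑ d ∈ Finset.Ioc 3 a, 1 / (d : ℝ) := by gcongr
    _ = ∑ d ∈ Finset.Ioc 3 a, g / d := by simp only [Finset.mul_sum, mul_one_div]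
    _ ≤ ∑ d ∈ Finset.Ioc 3 a, C * f (k - d) := Finset.sum_le_sum fun d hd => by
        have hd0 : (0 : ℝ) < d := by
          exact_mod_cast (show 0 < d by have := (Finset.mem_Ioc.1 hd).1; omega)
        rw [div_le_iff₀ hd0]
        linarith [hfg d hd]
    _ = C * ∑ j ∈ (Finset.Ioc 3 a).image (k - ·), f j := by
        rw [← Finset.mul_sum, Finset.sum_image hinj]
    _ ≤ C * ∑ j ∈ Finset.Ico a k, f j := by
        gcongr
        · exact fun j _ _ => hf j
        · intro j hj
          obtain ⟨d, hd, rfl⟩ := Finset.mem_image.1 hj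
          rw [Finset.mem_Ioc] at hd
          exact Finset.mem_Ico.2 ⟨by omega, by omega⟩

section Finite

variable {β : ℝ} {Q : ℕ → Measure (ℕ → ℕ)}

theorem exists_real_le_mul_real_skipEvent_inter (h : IsWalkFamily (upProb (perturbation β)) Q) :
    ∃ C : ℝ, 1 ≤ C ∧ ∀ᶠ j in atTop, ∀ (x k : ℕ) (D : Set (ℕ → ℕ)), MeasurableSet D →
      D ⊆ skipEvent k → (∀ y < k, consPath y ⁻¹' D = D) → x < j → k ∈ Set.Ioc (j + 3) (j ^ 2) →
      (Q x).real D ≤ C * ((k : ℝ) - j) * (Q x).real (skipEvent j ∩ D) := by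
  obtain ⟨C, hC, hcomp⟩ := exists_logRate_le_mul β
  obtain ⟨N, hr⟩ := exists_isBarrierRate β
  refine ⟨324 * C, by linarith, ?_⟩
  filter_upwards [(tendsto_add_atTop_nat 1).eventually hcomp, eventually_ge_atTop (N + 3)]
    with j hj hjN x k D hD hDk hDc hx hk
  have hsum : ∑ i ∈ Finset.Ioc j (k - 1), logRate β i ≤ ((k : ℝ) - j) * C * logRate β (j + 1) := by
    have hpos := (hr.mem_Ioc (j + 1) (by omega)).1
    calc ∑ i ∈ Finset.Ioc j (k - 1), logRate β i
        ≤ (Finset.Ioc j (k - 1)).card • (C * logRate β (j + 1)) :=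
          Finset.sum_le_card_nsmul _ _ _ fun i hi => by
            rw [Finset.mem_Ioc] at hi
            exact hj i ⟨hi.1, by nlinarith [hk.2, show i ≤ k by omega]⟩
      _ ≤ ((k : ℝ) - j) * C * logRate β (j + 1) := by
          rw [Nat.card_Ioc, nsmul_eq_mul, mul_assoc]
          gcongr
          rw [← Nat.cast_sub (by have := hk.1; omega)]
          exact_mod_cast (by omega)
  refine (hr.real_le_mul_real_skipEvent_inter h hD hDk hDc hx hjN hk.1 hsum).trans_eq ?_
  ring

theorem exists_sum_real_skip_inter_lastSkip_le (h : IsWalkFamily (upProb (perturbation β)) Q)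
    (x : ℕ) : ∃ C : ℝ, 1 ≤ C ∧ ∀ᶠ a : ℕ in atTop, ∀ j ∈ Finset.Ico a (8 * a),
      ∑ k ∈ Finset.Ico (2 * a) (8 * a), (Q x).real (skipEvent j ∩ lastSkipEvent k (8 * a)) ≤
        C * logRate β a := by
  obtain ⟨C, hC, hcomp⟩ := exists_logRate_le_mul β
  obtain ⟨N, hesc⟩ := eventually_atTop.1 (eventually_escProb_mem h)
  refine ⟨6 * C, by linarith, ?_⟩
  filter_upwards [hcomp, eventually_ge_atTop N, eventually_ge_atTop 8, eventually_gt_atTop x]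
    with a ha haN ha8 hax j hj
  rw [Finset.mem_Ico] at hj
  have := h.isProbabilityMeasure x
  calc ∑ k ∈ Finset.Ico (2 * a) (8 * a), (Q x).real (skipEvent j ∩ lastSkipEvent k (8 * a))
      = (Q x).real (⋃ k ∈ Finset.Ico (2 * a) (8 * a), skipEvent j ∩ lastSkipEvent k (8 * a)) :=
        (measureReal_biUnion_finset
          (((pairwiseDisjoint_lastSkipEvent _).subset fun k hk => (Finset.mem_Ico.1 hk).2).mono
            fun _ => Set.inter_subset_right)
          fun k _ => (measurableSet_skipEvent j).inter (measurableSet_lastSkipEvent k _)).symm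
    _ ≤ skipProb Q j x :=
        h.real_mono x (Set.iUnion₂_subset fun _ _ => Set.inter_subset_left)
    _ ≤ escProb Q j := h.real_le_real_succ (measurableSet_skipEvent j) subset_rfl
        (fun y hy => preimage_consPath_skipEvent hy.ne) (by omega)
    _ ≤ 6 * logRate β j := (hesc j (haN.trans hj.1)).2
    _ ≤ 6 * C * logRate β a := by linarith [ha j ⟨hj.1, by nlinarith⟩]

theorem exists_real_lastSkip_mul_log_le (h : IsWalkFamily (upProb (perturbation β)) Q) (x : ℕ) :
    ∃ C : ℝ, 1 ≤ C ∧ ∀ᶠ a : ℕ in atTop, ∀ k ∈ Finset.Ico (2 * a) (8 * a),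
      (Q x).real (lastSkipEvent k (8 * a)) * (1 / 2 * Real.log a) ≤
        C * ∑ j ∈ Finset.Ico a (8 * a), (Q x).real (skipEvent j ∩ lastSkipEvent k (8 * a)) := by
  obtain ⟨C, hC, hcluster⟩ := exists_real_le_mul_real_skipEvent_inter h
  obtain ⟨N, hN⟩ := eventually_atTop.1 hcluster
  refine ⟨C, hC, ?_⟩
  filter_upwards [eventually_ge_atTop N, eventually_gt_atTop x, eventually_ge_atTop 8,
    tendsto_log_natCast.eventually_ge_atTop (2 * Real.log 4)] with a haN hax ha8 hlog k hk
  rw [Finset.mem_Ico] at hk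
  refine (mul_half_log_le_mul_sum_Ico measureReal_nonneg (by linarith)
    (fun j => measureReal_nonneg) (fun d hd => ?_) hlog (by omega) hk.1).trans
    (mul_le_mul_of_nonneg_left (Finset.sum_le_sum_of_subset_of_nonneg
      (Finset.Ico_subset_Ico_right hk.2.le) fun _ _ _ => measureReal_nonneg) (by linarith))
  rw [Finset.mem_Ioc] at hd
  have := hN (k - d) (by omega) x k _ (measurableSet_lastSkipEvent k (8 * a))
    (lastSkipEvent_subset _ _) (fun y hy => preimage_consPath_lastSkipEvent _ hy) (by omega)
    ⟨by omega, by nlinarith [show a ≤ k - d by omega]⟩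
  rwa [Nat.cast_sub (by omega), sub_sub_cancel] at this

-- The last skipped site of a block is accompanied by about `log a` earlier skipped sites, so
-- skipping in a block is less likely than the expected number of skipped sites by that factor.
theorem exists_real_block_le (h : IsWalkFamily (upProb (perturbation β)) Q) (x : ℕ) :
    ∃ C : ℝ, ∀ᶠ a : ℕ in atTop,
      (Q x).real (⋃ k ∈ Finset.Ico (2 * a) (8 * a), skipEvent k) ≤
        C * (slowFactor β a / Real.log a) := by
  obtain ⟨C₁, hC₁, hrow⟩ := exists_real_lastSkip_mul_log_le h x
  obtain ⟨C₂, _, hcolumn⟩ := exists_sum_real_skip_inter_lastSkip_le h x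
  refine ⟨14 * C₁ * C₂, ?_⟩
  filter_upwards [hrow, hcolumn, eventually_ge_atTop 3] with a hrow hcol ha
  have hlog0 : 0 < Real.log a := by linarith [one_lt_log_natCast ha]
  set s := Finset.Ico (2 * a) (8 * a)
  have hunion : (Q x).real (⋃ k ∈ s, skipEvent k) ≤
      ∑ k ∈ s, (Q x).real (lastSkipEvent k (8 * a)) :=
    (h.real_mono x (biUnion_skipEvent_subset _ _)).trans (measureReal_biUnion_finset_le _ _)
  have htotal : (∑ k ∈ s, (Q x).real (lastSkipEvent k (8 * a))) * (1 / 2 * Real.log a) ≤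
      C₁ * (7 * a * (C₂ * logRate β a)) := by
    rw [Finset.sum_mul]
    refine (Finset.sum_le_sum hrow).trans ?_
    rw [← Finset.mul_sum, Finset.sum_comm]
    gcongr
    refine (Finset.sum_le_card_nsmul _ _ _ hcol).trans_eq ?_
    rw [Nat.card_Ico, show 8 * a - a = 7 * a by omega, nsmul_eq_mul]
    push_cast
    ring
  rw [logRate] at htotal
  field_simp at htotal ⊢
  nlinarith

end Finite

theorem summable_log_rpow_div {β : ℝ} (hβ : 1 < β) :
    Summable fun n : ℕ => Real.log n ^ (-β) / n := by
  refine (summable_condensed_iff_of_eventually_nonneg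
    (Eventually.of_forall fun n => ?_) ?_).1 ?_
  · have := Real.log_natCast_nonneg n
    simp only [Pi.zero_apply]
    positivity
  · filter_upwards [eventually_ge_atTop 3] with n hn
    have hlog := one_lt_log_natCast hn
    have hn0 : (0 : ℝ) < n := by positivity
    gcongr ?_ / ?_
    · exact Real.rpow_le_rpow_of_nonpos (by linarith)
        (Real.log_le_log hn0 (by push_cast; linarith)) (by linarith)
    · push_cast
      linarith
  · refine ((Real.summable_nat_rpow.2 (neg_lt_neg hβ)).mul_left (Real.log 2 ^ (-β))).congr
      fun k => ?_
    have hlog2 : 0 ≤ Real.log 2 := Real.log_nonneg one_le_two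
    push_cast
    rw [Real.log_pow, Real.mul_rpow (Nat.cast_nonneg k) hlog2, mul_div_cancel₀ _ (by positivity)]
    ring

theorem summable_slowFactor_four_pow_div_log {β : ℝ} (hβ : 1 < β) :
    Summable fun m : ℕ => slowFactor β (4 ^ m) / Real.log (4 ^ m : ℕ) := by
  refine Summable.of_norm_bounded_eventually_nat (summable_log_rpow_div hβ) ?_
  filter_upwards [eventually_ge_atTop 3] with m hm
  have hlogm := Real.log_pos (one_lt_log_natCast hm |>.trans_le (Real.log_le_self (by positivity)))
  have hlog4 : 1 < Real.log 4 := mod_cast one_lt_log_natCast (show 3 ≤ 4 by norm_num)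
  have hm0 : (0 : ℝ) < m := by positivity
  have hle : (m : ℝ) ≤ Real.log (4 ^ m : ℕ) := by
    push_cast
    rw [Real.log_pow]
    nlinarith
  have hslow := slowFactor_pos β (show 3 ≤ 4 ^ m from hm.trans (Nat.lt_pow_self (by norm_num)).le)
  rw [Real.norm_of_nonneg (div_nonneg hslow.le (hm0.le.trans hle))]
  gcongr
  exact Real.rpow_le_rpow_of_nonpos hlogm (Real.log_le_log hm0 hle) (by linarith)

theorem finite_of_eventually_disjoint_Ico {s : Set ℕ}
    (hs : ∀ᶠ m in atTop, ∀ k ∈ Finset.Ico (2 * 4 ^ m) (8 * 4 ^ m), k ∉ s) : s.Finite := by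
  obtain ⟨M, hM⟩ := eventually_atTop.1 hs
  refine (Set.finite_lt_nat (2 * 4 ^ M)).subset fun k hk => ?_
  by_contra hlt
  have hMk : 2 * 4 ^ M ≤ k := not_lt.1 hlt
  have hquot : k / 2 ≠ 0 := by
    have : 0 < 4 ^ M := by positivity
    omega
  have hlower := Nat.pow_log_le_self 4 hquot
  have hupper := Nat.lt_pow_succ_log_self (show 1 < 4 by norm_num) (k / 2)
  rw [pow_succ] at hupper
  exact hM (Nat.log 4 (k / 2)) (Nat.le_log_of_pow_le (by norm_num) (by omega)) k
    (Finset.mem_Ico.2 ⟨by omega, by omega⟩) hk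

theorem ae_finite_skipped {β : ℝ} {Q : ℕ → Measure (ℕ → ℕ)}
    (h : IsWalkFamily (upProb (perturbation β)) Q) (hβ : 1 < β) (x : ℕ) :
    ∀ᵐ ω ∂Q x, {k | ω ∈ skipEvent k}.Finite := by
  have := h.isProbabilityMeasure x
  obtain ⟨C, hblock⟩ := exists_real_block_le h x
  have hsum : Summable fun m : ℕ =>
      (Q x).real (⋃ k ∈ Finset.Ico (2 * 4 ^ m) (8 * 4 ^ m), skipEvent k) := by
    refine Summable.of_norm_bounded_eventually_nat
      ((summable_slowFactor_four_pow_div_log hβ).mul_left C) ?_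
    filter_upwards [(tendsto_pow_atTop_atTop_of_one_lt (show 1 < 4 by norm_num)).eventually
      hblock] with m hm
    rwa [Real.norm_of_nonneg measureReal_nonneg]
  have htsum := hsum.tsum_ofReal_ne_top
  simp only [measureReal_def, ENNReal.ofReal_toReal (measure_ne_top _ _)] at htsum
  filter_upwards [ae_eventually_notMem htsum] with ω hω
  refine finite_of_eventually_disjoint_Ico (hω.mono fun m hm k hk hωk => hm ?_)
  exact Set.mem_biUnion hk hωk

/-! ### A weighted Kochen–Stone lemma -/

section KochenStone

variable {Ω ι : Type*}

/-- The number of indices in `s` whose event contains `ω`, each index `k` counted with weight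
`w k`: the random variable of the second moment method. -/
noncomputable def weightedCount (w : ι → ℝ) (E : ι → Set Ω) (s : Finset ι) (ω : Ω) : ℝ :=
  ∑ k ∈ s, (E k).indicator (fun _ => w k) ω

variable {E : ι → Set Ω} (w : ι → ℝ)

theorem weightedCount_sq (s : Finset ι) (ω : Ω) :
    weightedCount w E s ω ^ 2 =
      weightedCount (fun i : ι × ι => w i.1 * w i.2) (fun i => E i.1 ∩ E i.2) (s ×ˢ s) ω := by
  simp only [weightedCount, sq, Finset.sum_mul_sum, Finset.sum_product, Set.inter_indicator_mul]

theorem weightedCount_le_sum_abs {ω : Ω} (hfin : {k | ω ∈ E k}.Finite) (s : Finset ι) :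
    weightedCount w E s ω ≤ ∑ k ∈ hfin.toFinset, |w k| := by
  classical
  calc weightedCount w E s ω ≤ ∑ k ∈ s, if k ∈ hfin.toFinset then |w k| else 0 := by
        refine Finset.sum_le_sum fun k _ => ?_
        by_cases hk : ω ∈ E k <;> simp [hk, le_abs_self]
    _ = ∑ k ∈ s ∩ hfin.toFinset, |w k| := Finset.sum_ite_mem _ _ _
    _ ≤ ∑ k ∈ hfin.toFinset, |w k| := Finset.sum_le_sum_of_subset_of_nonneg
        Finset.inter_subset_right fun _ _ _ => abs_nonneg _

variable [MeasurableSpace Ω] {μ : Measure Ω} [IsProbabilityMeasure μ]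

theorem one_div_le_real_half_integral_lt {Z : Ω → ℝ} {K : ℝ} (hZ : Measurable Z)
    (hZ2 : MemLp Z 2 μ) (hK : 0 < K) (hmean : 0 < ∫ ω, Z ω ∂μ)
    (hsq : ∫ ω, Z ω ^ 2 ∂μ ≤ K * (∫ ω, Z ω ∂μ) ^ 2) :
    1 / (4 * K) ≤ μ.real {ω | (∫ ω, Z ω ∂μ) / 2 < Z ω} := by
  set M := ∫ ω, Z ω ∂μ
  set E := {ω | M / 2 < Z ω}
  have hE : MeasurableSet E := measurableSet_lt measurable_const hZ
  -- AM-GM on `E`, with the factor that makes the square cost a quarter of the mean.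
  have hpointwise : ∀ ω, Z ω ≤
      M / 2 + 1 / (4 * (K * M)) * Z ω ^ 2 + E.indicator (fun _ => K * M) ω := by
    intro ω
    have hsq0 : 0 ≤ 1 / (4 * (K * M)) * Z ω ^ 2 := by positivity
    by_cases hω : ω ∈ E
    · have hamgm : Z ω ≤ 1 / (4 * (K * M)) * Z ω ^ 2 + K * M := by
        rw [← sub_nonneg, show 1 / (4 * (K * M)) * Z ω ^ 2 + K * M - Z ω =
          (Z ω - 2 * (K * M)) ^ 2 / (4 * (K * M)) by field_simp; ring]
        positivity
      rw [Set.indicator_of_mem hω]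
      linarith
    · rw [Set.indicator_of_notMem hω]
      linarith [not_lt.1 (show ¬M / 2 < Z ω from hω)]
  have hint : Integrable (fun ω => M / 2 + 1 / (4 * (K * M)) * Z ω ^ 2) μ :=
    (integrable_const _).add (hZ2.integrable_sq.const_mul _)
  have hEint : Integrable (E.indicator fun _ => K * M) μ := (integrable_const _).indicator hE
  have hmono := integral_mono (hZ2.integrable one_le_two) (hint.add hEint) hpointwise
  simp only [Pi.add_apply] at hmono
  rw [integral_add hint hEint, integral_add (integrable_const _) (hZ2.integrable_sq.const_mul _),
    integral_const_mul, integral_indicator_const _ hE, integral_const, probReal_univ, one_smul,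
    smul_eq_mul] at hmono
  have hquarter : 1 / (4 * (K * M)) * ∫ ω, Z ω ^ 2 ∂μ ≤ M / 4 :=
    (mul_le_mul_of_nonneg_left hsq (by positivity)).trans_eq (by field_simp)
  rw [div_le_iff₀ (by positivity)]
  refine le_of_mul_le_mul_right ?_ hmean
  linarith

theorem le_real_frequently_of_eventually_le_real {F : ℕ → Set Ω} {c : ℝ}
    (hF : ∀ n, MeasurableSet (F n)) (hc : ∀ᶠ n in atTop, c ≤ μ.real (F n)) :
    c ≤ μ.real {ω | ∃ᶠ n in atTop, ω ∈ F n} := by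
  have hset : {ω | ∃ᶠ n in atTop, ω ∈ F n} = ⋂ N, ⋃ n ≥ N, F n := by
    ext ω
    simp [frequently_atTop]
  have hlim : Tendsto (fun N => μ.real (⋃ n ≥ N, F n)) atTop
      (𝓝 (μ.real (⋂ N, ⋃ n ≥ N, F n))) :=
    (ENNReal.tendsto_toReal (measure_ne_top _ _)).comp <| tendsto_measure_iInter_atTop
      (fun N =>
        (MeasurableSet.iUnion fun n => MeasurableSet.iUnion fun _ => hF n).nullMeasurableSet)
      (fun N N' hN => Set.iUnion₂_mono' fun n hn => ⟨n, hN.trans hn, le_rfl⟩)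
      ⟨0, measure_ne_top _ _⟩
  rw [hset]
  refine ge_of_tendsto hlim ?_
  filter_upwards [hc] with N hN
  exact hN.trans (measureReal_mono (Set.subset_iUnion₂_of_subset N le_rfl subset_rfl)
    (measure_ne_top _ _))

theorem measurable_weightedCount (hE : ∀ k, MeasurableSet (E k)) (s : Finset ι) :
    Measurable (weightedCount w E s) :=
  Finset.measurable_sum _ fun k _ => measurable_const.indicator (hE k)

theorem memLp_weightedCount (hE : ∀ k, MeasurableSet (E k)) (s : Finset ι) (q : ENNReal) :
    MemLp (weightedCount w E s) q μ :=
  memLp_finsetSum _ fun k _ => (memLp_const (w k)).indicator (hE k)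

theorem integral_weightedCount (hE : ∀ k, MeasurableSet (E k)) (s : Finset ι) :
    ∫ ω, weightedCount w E s ω ∂μ = ∑ k ∈ s, w k * μ.real (E k) := by
  unfold weightedCount
  rw [integral_finsetSum _ fun k _ => (integrable_const (w k)).indicator (hE k)]
  refine Finset.sum_congr rfl fun k _ => ?_
  rw [integral_indicator_const _ (hE k), smul_eq_mul, mul_comm]

theorem integral_weightedCount_sq (hE : ∀ k, MeasurableSet (E k)) (s : Finset ι) :
    ∫ ω, weightedCount w E s ω ^ 2 ∂μ =
      ∑ j ∈ s, ∑ k ∈ s, w j * w k * μ.real (E j ∩ E k) := by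
  simp only [weightedCount_sq]
  rw [integral_weightedCount (E := fun i : ι × ι => E i.1 ∩ E i.2) _
    fun i => (hE i.1).inter (hE i.2), Finset.sum_product]

theorem one_div_le_real_setOf_infinite {s : ℕ → Finset ι} {K : ℝ}
    (hE : ∀ k, MeasurableSet (E k)) (hK : 0 < K)
    (hmean : Tendsto (fun n => ∑ k ∈ s n, w k * μ.real (E k)) atTop atTop)
    (hsq : ∀ᶠ n in atTop, ∑ j ∈ s n, ∑ k ∈ s n, w j * w k * μ.real (E j ∩ E k) ≤
      K * (∑ k ∈ s n, w k * μ.real (E k)) ^ 2) :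
    1 / (4 * K) ≤ μ.real {ω | {k | ω ∈ E k}.Infinite} := by
  let M : ℕ → ℝ := fun n => ∑ k ∈ s n, w k * μ.real (E k)
  have hlarge : ∀ᶠ n in atTop, 1 / (4 * K) ≤ μ.real {ω | M n / 2 < weightedCount w E (s n) ω} := by
    filter_upwards [hsq, hmean.eventually_gt_atTop 0] with n hn hpos
    have := one_div_le_real_half_integral_lt (μ := μ) (K := K)
      (measurable_weightedCount w hE (s n)) (memLp_weightedCount w hE (s n) 2) hK
    rw [integral_weightedCount_sq w hE, integral_weightedCount w hE] at this
    exact this hpos hn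
  refine (le_real_frequently_of_eventually_le_real (fun n => measurableSet_lt measurable_const
    (measurable_weightedCount w hE (s n))) hlarge).trans (measureReal_mono fun ω hω hfin => ?_)
  have hbig : ∀ᶠ n in atTop, 2 * ∑ k ∈ hfin.toFinset, |w k| < M n := hmean.eventually_gt_atTop _
  obtain ⟨n, hn, hMn⟩ := (Frequently.and_eventually hω hbig).exists
  have hn : M n / 2 < weightedCount w E (s n) ω := hn
  linarith [weightedCount_le_sum_abs w hfin (s n)]

end KochenStone

theorem sum_sum_le_of_near_far {ι : Type*} [LinearOrder ι] {I : Finset ι} {S : ι → Finset ι}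
    {F : ι → ι → ℝ} {a : ι → ℝ} {B C : ℝ} (hF : ∀ j ∈ I, ∀ k ∈ I, 0 ≤ F j k)
    (hsymm : ∀ j k, F j k = F k j) (ha : ∀ j ∈ I, 0 ≤ a j) (hB : 0 ≤ B)
    (hdiag : ∀ j ∈ I, F j j ≤ a j) (hnear : ∀ j ∈ I, ∑ k ∈ I with k ∈ S j, F j k ≤ C * a j)
    (hfar : ∀ j ∈ I, ∀ k ∈ I, j < k → k ∉ S j → F j k ≤ B * (a j * a k)) :
    ∑ j ∈ I, ∑ k ∈ I, F j k ≤ (1 + 2 * C) * ∑ j ∈ I, a j + B * (∑ j ∈ I, a j) ^ 2 := by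
  let G : ι → ι → ℝ := fun j k => if k ∈ S j then F j k else 0
  have hG : ∀ j ∈ I, ∀ k ∈ I, 0 ≤ G j k := fun j hj k hk => by
    dsimp only [G]
    split_ifs
    exacts [hF j hj k hk, le_rfl]
  have hlt : ∀ j ∈ I, ∀ k ∈ I, j < k → F j k ≤ G j k + B * (a j * a k) := by
    intro j hj k hk hjk
    by_cases hkS : k ∈ S j
    · have := mul_nonneg hB (mul_nonneg (ha j hj) (ha k hk))
      simpa [G, hkS] using this
    · simpa [G, hkS] using hfar j hj k hk hjk hkS
  have hpointwise : ∀ j ∈ I, ∀ k ∈ I,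
      F j k ≤ (if j = k then a j else 0) + G j k + G k j + B * (a j * a k) := by
    intro j hj k hk
    obtain hjk | rfl | hkj := lt_trichotomy j k
    · rw [if_neg hjk.ne]
      linarith [hlt j hj k hk hjk, hG k hk j hj]
    · rw [if_pos rfl]
      linarith [hdiag j hj, hG j hj j hj, mul_nonneg hB (mul_nonneg (ha j hj) (ha j hj))]
    · rw [if_neg hkj.ne', hsymm j k, mul_comm (a j)]
      linarith [hlt k hk j hj hkj, hG j hj k hk]
  have hGsum : ∑ j ∈ I, ∑ k ∈ I, G j k ≤ C * ∑ j ∈ I, a j := by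
    rw [Finset.mul_sum]
    exact Finset.sum_le_sum fun j hj => by simpa only [G, Finset.sum_filter] using hnear j hj
  have hdiag_sum : ∑ j ∈ I, ∑ k ∈ I, (if j = k then a j else 0) = ∑ j ∈ I, a j :=
    Finset.sum_congr rfl fun j hj => by rw [Finset.sum_ite_eq, if_pos hj]
  calc ∑ j ∈ I, ∑ k ∈ I, F j k
      ≤ ∑ j ∈ I, ∑ k ∈ I, ((if j = k then a j else 0) + G j k + G k j + B * (a j * a k)) :=
        Finset.sum_le_sum fun j hj => Finset.sum_le_sum fun k hk => hpointwise j hj k hk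
    _ = ∑ j ∈ I, a j + ∑ j ∈ I, ∑ k ∈ I, G j k + ∑ j ∈ I, ∑ k ∈ I, G k j +
        B * (∑ j ∈ I, a j) ^ 2 := by
        rw [sq, Finset.sum_mul_sum]
        simp only [Finset.sum_add_distrib, hdiag_sum, Finset.mul_sum]
    _ ≤ (1 + 2 * C) * ∑ j ∈ I, a j + B * (∑ j ∈ I, a j) ^ 2 := by
        rw [Finset.sum_comm (f := fun j k => G k j)]
        linarith

/-! ### Infinitely many skipped points for `β ≤ 1` -/

theorem exists_logRate_succ_le_mul_sum (β : ℝ) : ∃ C : ℝ, 1 ≤ C ∧ ∀ᶠ j : ℕ in atTop, ∀ k, j < k →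
    logRate β (j + 1) ≤
      C * (∑ i ∈ Finset.Ioc j k, logRate β i) * (1 / ((k : ℝ) - j) + 1 / j) := by
  obtain ⟨C, hC, hcomp⟩ := exists_logRate_le_mul_of_le_two_mul β
  refine ⟨2 * C, by linarith, ?_⟩
  filter_upwards [hcomp, eventually_logRate_succ_mem β, eventually_ge_atTop 3]
    with j hj hsucc hj3 k hjk
  set l := min k (2 * j)
  have hjl : j < l := by omega
  have hlj : (0 : ℝ) < l - j := sub_pos.2 (by exact_mod_cast hjl)
  have hkj : (0 : ℝ) < k - j := sub_pos.2 (by exact_mod_cast hjk)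
  have hsum : logRate β j * (l - j) ≤ C * ∑ i ∈ Finset.Ioc j k, logRate β i :=
    calc logRate β j * (l - j) = ∑ _i ∈ Finset.Ioc j l, logRate β j := by
          rw [Finset.sum_const, nsmul_eq_mul, Nat.card_Ioc, Nat.cast_sub hjl.le, mul_comm]
      _ ≤ ∑ i ∈ Finset.Ioc j l, C * logRate β i := Finset.sum_le_sum fun i hi => by
          have := Finset.mem_Ioc.1 hi
          exact hj i ⟨by omega, by omega⟩
      _ = C * ∑ i ∈ Finset.Ioc j l, logRate β i := (Finset.mul_sum _ _ _).symm
      _ ≤ C * ∑ i ∈ Finset.Ioc j k, logRate β i := by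
          gcongr with i hi
          · intro i hi _
            exact (logRate_pos β (by have := Finset.mem_Ioc.1 hi; omega)).le
          · exact min_le_left _ _
  have hinv : 1 / ((l : ℝ) - j) ≤ 1 / ((k : ℝ) - j) + 1 / j := by
    obtain hlk | hlj' : l = k ∨ l = 2 * j := by omega
    · rw [hlk]
      exact le_add_of_nonneg_right (by positivity)
    · rw [hlj', Nat.cast_mul, Nat.cast_two, two_mul, add_sub_cancel_right]
      exact le_add_of_nonneg_left (by positivity)
  have hsum0 : 0 ≤ C * ∑ i ∈ Finset.Ioc j k, logRate β i :=
    hsum.trans' (mul_nonneg (logRate_pos β hj3).le hlj.le)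
  calc logRate β (j + 1) ≤ 2 * logRate β j := hsucc.2
    _ ≤ 2 * ((C * ∑ i ∈ Finset.Ioc j k, logRate β i) * (1 / ((l : ℝ) - j))) := by
        rw [mul_one_div]
        gcongr
        exact (le_div_iff₀ hlj).2 hsum
    _ ≤ 2 * ((C * ∑ i ∈ Finset.Ioc j k, logRate β i) * (1 / ((k : ℝ) - j) + 1 / j)) := by gcongr
    _ = _ := by ring

section SecondMoment

variable {β : ℝ} {Q : ℕ → Measure (ℕ → ℕ)}

theorem exists_real_skip_inter_skip_le (h : IsWalkFamily (upProb (perturbation β)) Q) :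
    ∃ C : ℝ, 1 ≤ C ∧ ∀ᶠ j : ℕ in atTop, ∀ k, j < k →
      (Q (j + 1)).real (skipEvent j ∩ skipEvent k) ≤
        C * escProb Q k * (1 / ((k : ℝ) - j) + 1 / j + logRate β j) := by
  obtain ⟨C, hC, hrate⟩ := exists_logRate_succ_le_mul_sum β
  obtain ⟨N, hr⟩ := exists_isBarrierRate β
  refine ⟨C + 4, by linarith, ?_⟩
  filter_upwards [hrate, eventually_logRate_succ_mem β, eventually_ge_atTop N,
    eventually_ge_atTop 3] with j hrate hsucc hjN hj3 k hjk
  set y := 1 / ((k : ℝ) - j) + 1 / j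
  set s := ∑ i ∈ Finset.Ioc j k, logRate β i
  have hy : 0 ≤ y := add_nonneg (one_div_nonneg.2 (sub_nonneg.2 (by exact_mod_cast hjk.le)))
    (by positivity)
  have ht := logRate_pos β hj3
  have hesc := hr.escProb_pos h (hjN.trans hjk.le)
  have hs : 0 < s := Finset.sum_pos (fun i hi => logRate_pos β
    (hj3.trans (Finset.mem_Ioc.1 hi).1.le)) (Finset.nonempty_Ioc.2 hjk)
  refine le_of_mul_le_mul_right ?_ hs
  calc (Q (j + 1)).real (skipEvent j ∩ skipEvent k) * s
      ≤ escProb Q k * logRate β (j + 1) * (1 + 2 * s) :=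
        hr.real_skip_inter_skip_mul_sum_le h hjN hjk
    _ = escProb Q k * (logRate β (j + 1) + 2 * logRate β (j + 1) * s) := by ring
    _ ≤ escProb Q k * (C * s * y + 2 * (2 * logRate β j) * s) := by
        gcongr
        exacts [hrate k hjk, hsucc.2]
    _ = (C * escProb Q k * y + 4 * escProb Q k * logRate β j) * s := by ring
    _ ≤ ((C + 4) * escProb Q k * y + (C + 4) * escProb Q k * logRate β j) * s := by
        gcongr <;> linarith
    _ = (C + 4) * escProb Q k * (y + logRate β j) * s := by ring

end SecondMoment

/-- The weight of the site `k` in the weighted count of skipped sites. It is chosen so that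
`skipWeight β k * logRate β k = 1 / (k * log k * log (log k))`, which barely fails to be summable:
the mean count diverges, while skips close to a skipped site contribute boundedly. -/
noncomputable def skipWeight (β : ℝ) (k : ℕ) : ℝ :=
  1 / (slowFactor β k * Real.log k * Real.log (Real.log k))

theorem skipWeight_pos (β : ℝ) {k : ℕ} (hk : 3 ≤ k) : 0 < skipWeight β k :=
  one_div_pos.2 (mul_pos (mul_pos (slowFactor_pos β hk) (one_pos.trans (one_lt_log_natCast hk)))
    (log_log_natCast_pos hk))

theorem skipWeight_mul_logRate (β : ℝ) {k : ℕ} (hk : 3 ≤ k) :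
    skipWeight β k * logRate β k = 1 / (k * Real.log k * Real.log (Real.log k)) := by
  have hS := slowFactor_pos β hk
  unfold skipWeight logRate
  rw [div_mul_div_comm, one_mul, show slowFactor β k * Real.log k * Real.log (Real.log k) * k =
    slowFactor β k * (k * Real.log k * Real.log (Real.log k)) by ring, ← div_div, div_self hS.ne']

theorem one_le_slowFactor_mul_log_log {β : ℝ} (hβ : β ≤ 1) {k : ℕ}
    (hk : 1 ≤ Real.log (Real.log k)) : 1 ≤ slowFactor β k * Real.log (Real.log k) := by
  rw [slowFactor, ← Real.rpow_add_one (by linarith)]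
  exact Real.one_le_rpow hk (by linarith)

theorem skipWeight_le_one {β : ℝ} (hβ : β ≤ 1) {k : ℕ} (hk3 : 3 ≤ k)
    (hk : 1 ≤ Real.log (Real.log k)) : skipWeight β k ≤ 1 := by
  have hslow := one_le_slowFactor_mul_log_log hβ hk
  have hlog := one_lt_log_natCast hk3
  rw [skipWeight, mul_right_comm]
  exact div_le_one_of_le₀ (one_le_mul_of_one_le_of_one_le hslow hlog.le) (by positivity)

theorem sum_Ioc_one_div_sub_le {j n : ℕ} (hjn : j < n) :
    ∑ k ∈ Finset.Ioc j n, 1 / ((k : ℝ) - j) ≤ 1 + Real.log (n - j) := by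
  induction n, Nat.succ_le_of_lt hjn using Nat.le_induction with
  | base => simp
  | succ n hn ih =>
    have hpos : (0 : ℝ) < n - j := sub_pos.2 (by exact_mod_cast hn)
    rw [← Finset.insert_Ioc_right_eq_Ioc_add_one (by omega), Finset.sum_insert (by simp),
      show ((n + 1 : ℕ) : ℝ) - j = n - j + 1 by push_cast; ring]
    linarith [one_div_add_one_le_log_sub_log hpos, ih hn]

theorem sum_Ioc_sq_one_div_sub_le {j : ℕ} (hj : 3 ≤ j) :
    ∑ k ∈ Finset.Ioc j (j ^ 2), 1 / ((k : ℝ) - j) ≤ 3 * Real.log j := by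
  have hj' : (3 : ℝ) ≤ j := by exact_mod_cast hj
  calc ∑ k ∈ Finset.Ioc j (j ^ 2), 1 / ((k : ℝ) - j)
      ≤ 1 + Real.log ((j ^ 2 : ℕ) - j) := sum_Ioc_one_div_sub_le (by nlinarith)
    _ ≤ 1 + Real.log ((j : ℝ) ^ 2) := by
        push_cast
        gcongr
        · nlinarith
        · linarith
    _ ≤ 3 * Real.log j := by
        rw [Real.log_pow]
        push_cast
        linarith [one_lt_log_natCast hj]

theorem sum_Ioc_sq_one_div_le {j : ℕ} (hj : 3 ≤ j) :
    ∑ k ∈ Finset.Ioc j (j ^ 2), 1 / (k : ℝ) ≤ Real.log j := by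
  have := sum_Ioc_le_log_sub_log (show 0 < j by omega) (show j ≤ j ^ 2 by nlinarith)
  rw [Nat.cast_pow, Real.log_pow] at this
  push_cast at this
  linarith

theorem skipWeight_mul_logRate_le (β : ℝ) {j k : ℕ} (hj : 3 ≤ j) (hjk : j ≤ k) :
    skipWeight β k * logRate β k ≤ 1 / (k * Real.log j * Real.log (Real.log j)) := by
  have hj0 : (0 : ℝ) < j := by exact_mod_cast (by omega : 0 < j)
  have hk0 : (0 : ℝ) < k := hj0.trans_le (by exact_mod_cast hjk)
  have hlog := one_lt_log_natCast hj
  have hll := log_log_natCast_pos hj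
  rw [skipWeight_mul_logRate β (hj.trans hjk)]
  gcongr

theorem sum_skipWeight_mul_logRate_mul_le {β : ℝ} (hβ : β ≤ 1) {j : ℕ} (hj : 3 ≤ j)
    (hll : 1 ≤ Real.log (Real.log j)) :
    ∑ k ∈ Finset.Ioc j (j ^ 2), skipWeight β k * logRate β k *
      (1 / ((k : ℝ) - j) + 1 / j + logRate β j) ≤ 5 * logRate β j := by
  have hj0 : (0 : ℝ) < j := by exact_mod_cast (by omega : 0 < j)
  have ht := logRate_pos β hj
  set l := Real.log j
  set m := Real.log l
  have hl : 1 < l := one_lt_log_natCast hj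
  have hterm : ∀ k ∈ Finset.Ioc j (j ^ 2), skipWeight β k * logRate β k *
      (1 / ((k : ℝ) - j) + 1 / j + logRate β j) ≤
        1 / (j * l * m) * (1 / ((k : ℝ) - j)) + (1 / j + logRate β j) / (l * m) * (1 / k) := by
    intro k hk
    obtain ⟨hjk, -⟩ := Finset.mem_Ioc.1 hk
    have hjk' : (j : ℝ) < k := by exact_mod_cast hjk
    have hkj : 0 < (k : ℝ) - j := sub_pos.2 hjk'
    have hk0 : (0 : ℝ) < k := hj0.trans hjk'
    calc skipWeight β k * logRate β k * (1 / ((k : ℝ) - j) + 1 / j + logRate β j)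
        ≤ 1 / (k * l * m) * (1 / ((k : ℝ) - j) + 1 / j + logRate β j) := by
          gcongr
          exact skipWeight_mul_logRate_le β hj hjk.le
      _ = 1 / (k * l * m) * (1 / ((k : ℝ) - j)) + (1 / j + logRate β j) / (l * m) * (1 / k) := by
          field_simp
          ring
      _ ≤ _ := by gcongr
  have hjm : 1 / (j * m) ≤ logRate β j := by
    rw [logRate, div_le_div_iff₀ (by positivity) hj0]
    nlinarith [one_le_slowFactor_mul_log_log hβ hll]
  calc _ ≤ ∑ k ∈ Finset.Ioc j (j ^ 2), (1 / (j * l * m) * (1 / ((k : ℝ) - j)) +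
          (1 / j + logRate β j) / (l * m) * (1 / k)) := Finset.sum_le_sum hterm
    _ ≤ 1 / (j * l * m) * (3 * l) + (1 / j + logRate β j) / (l * m) * l := by
        rw [Finset.sum_add_distrib, ← Finset.mul_sum, ← Finset.mul_sum]
        gcongr
        exacts [sum_Ioc_sq_one_div_sub_le hj, sum_Ioc_sq_one_div_le hj]
    _ = 4 * (1 / (j * m)) + logRate β j / m := by
        field_simp
        ring
    _ ≤ 4 * logRate β j + logRate β j := by
        gcongr
        exact div_le_self ht.le hll
    _ = 5 * logRate β j := by ring

theorem log_log_log_succ_sub_le {n : ℕ} (hn : 3 ≤ n) :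
    Real.log (Real.log (Real.log (n + 1 : ℕ))) - Real.log (Real.log (Real.log n)) ≤
      1 / (n * Real.log n * Real.log (Real.log n)) := by
  have hn0 : (0 : ℝ) < n := by exact_mod_cast (by omega : 0 < n)
  have hlog := one_lt_log_natCast hn
  have hll := log_log_natCast_pos hn
  calc _ ≤ (Real.log (n + 1 : ℕ) - Real.log n) / (Real.log n * Real.log (Real.log n)) :=
        log_log_sub_log_log_le_div hlog (one_lt_log_natCast (by omega))
    _ ≤ (((n + 1 : ℕ) - n : ℝ) / n) / (Real.log n * Real.log (Real.log n)) := by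
        gcongr
        exact log_sub_log_le_div hn0 (by positivity)
    _ = 1 / (n * Real.log n * Real.log (Real.log n)) := by
        rw [div_div, mul_assoc, Nat.cast_add_one, add_sub_cancel_left]

theorem log_log_log_sub_le_sum_Ioc {N n : ℕ} (hN : 3 ≤ N) (hn : N ≤ n) :
    Real.log (Real.log (Real.log (n + 1 : ℕ))) - Real.log (Real.log (Real.log (N + 1 : ℕ))) ≤
      ∑ k ∈ Finset.Ioc N n, 1 / (k * Real.log k * Real.log (Real.log k)) := by
  induction n, hn using Nat.le_induction with
  | base => simp
  | succ n hn ih =>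
    rw [← Finset.insert_Ioc_right_eq_Ioc_add_one hn, Finset.sum_insert (by simp)]
    linarith [log_log_log_succ_sub_le (show 3 ≤ n + 1 by omega)]

theorem tendsto_sum_one_div_mul_log_mul_log_log {N : ℕ} (hN : 3 ≤ N) :
    Tendsto (fun n : ℕ => ∑ k ∈ Finset.Ioc N n, 1 / (k * Real.log k * Real.log (Real.log k)))
      atTop atTop := by
  have hlogs : Tendsto (fun n : ℕ => Real.log (Real.log (Real.log (n + 1 : ℕ))) -
      Real.log (Real.log (Real.log (N + 1 : ℕ)))) atTop atTop :=
    tendsto_atTop_add_const_right _ _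
      ((Real.tendsto_log_atTop.comp tendsto_log_log_natCast).comp (tendsto_add_atTop_nat 1))
  refine tendsto_atTop_mono' _ ?_ hlogs
  filter_upwards [eventually_ge_atTop N] with n hn using log_log_log_sub_le_sum_Ioc hN hn

theorem IsWalkFamily.real_skip_inter_skip_mul_escProb {p : ℕ → ℝ} {Q : ℕ → Measure (ℕ → ℕ)}
    (h : IsWalkFamily p Q) {x j k : ℕ} (hx : x ≤ j + 1) (hjk : j < k) :
    (Q x).real (skipEvent j ∩ skipEvent k) * escProb Q j =
      skipProb Q j x * (Q (j + 1)).real (skipEvent j ∩ skipEvent k) :=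
  h.real_mul_escProb ((measurableSet_skipEvent j).inter (measurableSet_skipEvent k))
    Set.inter_subset_left (fun y hy => by rw [Set.preimage_inter, preimage_consPath_skipEvent hy.ne,
      preimage_consPath_skipEvent (hy.trans hjk).ne]) hx

namespace IsBarrierRate

variable {p t : ℕ → ℝ} {N x j k : ℕ} {Q : ℕ → Measure (ℕ → ℕ)}

theorem escProb_div_eighteen_le_skipProb (hr : IsBarrierRate p t N) (h : IsWalkFamily p Q)
    (hk : N + 3 ≤ k) (hx : x < k) : escProb Q k / 18 ≤ skipProb Q k x := by
  obtain ⟨i, rfl⟩ : ∃ i, k = i + 3 := ⟨k - 3, by omega⟩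
  exact h.div_eighteen_le_real (measurableSet_skipEvent _)
    (fun y hy => preimage_consPath_skipEvent hy.ne)
    (fun n hn => hr.upProb_mem n (by have := hn.1; omega)) (by omega)

theorem real_skip_inter_skip_le_mul (hr : IsBarrierRate p t N) (h : IsWalkFamily p Q)
    (hj : N + 3 ≤ j) (hx : x < j) (hjk : j < k) (hsum : 1 ≤ ∑ i ∈ Finset.Ioc j k, t i) :
    (Q x).real (skipEvent j ∩ skipEvent k) ≤ 108 * (skipProb Q j x * skipProb Q k x) := by
  set s := ∑ i ∈ Finset.Ioc j k, t i
  have hescj := hr.escProb_pos h (show N ≤ j by omega)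
  have hesck := hr.escProb_pos h (show N ≤ k by omega)
  have habove : (Q (j + 1)).real (skipEvent j ∩ skipEvent k) ≤ 6 * (escProb Q j * escProb Q k) := by
    refine le_of_mul_le_mul_right ?_ (one_pos.trans_le hsum)
    calc (Q (j + 1)).real (skipEvent j ∩ skipEvent k) * s
        ≤ escProb Q k * t (j + 1) * (1 + 2 * s) :=
          hr.real_skip_inter_skip_mul_sum_le h (by omega) hjk
      _ ≤ escProb Q k * (2 * escProb Q j) * (3 * s) := by
          gcongr
          · linarith [hr.half_rate_le_escProb h (show N ≤ j by omega)]
          · linarith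
      _ = 6 * (escProb Q j * escProb Q k) * s := by ring
  refine le_of_mul_le_mul_right ?_ hescj
  calc (Q x).real (skipEvent j ∩ skipEvent k) * escProb Q j
      = skipProb Q j x * (Q (j + 1)).real (skipEvent j ∩ skipEvent k) :=
        h.real_skip_inter_skip_mul_escProb (by omega) hjk
    _ ≤ skipProb Q j x * (6 * (escProb Q j * (18 * skipProb Q k x))) := by
        have hskip := hr.escProb_div_eighteen_le_skipProb h (show N + 3 ≤ k by omega)
          (hx.trans hjk)
        refine mul_le_mul_of_nonneg_left (habove.trans ?_) measureReal_nonneg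
        gcongr
        linarith
    _ = 108 * (skipProb Q j x * skipProb Q k x) * escProb Q j := by ring

end IsBarrierRate

section SecondMoment

variable {β : ℝ} {Q : ℕ → Measure (ℕ → ℕ)}

theorem exists_sum_skipWeight_mul_real_succ_le (h : IsWalkFamily (upProb (perturbation β)) Q)
    (hβ : β ≤ 1) : ∃ C : ℝ, 0 ≤ C ∧ ∀ᶠ j : ℕ in atTop, ∑ k ∈ Finset.Ioc j (j ^ 2),
      skipWeight β k * (Q (j + 1)).real (skipEvent j ∩ skipEvent k) ≤ C * escProb Q j := by
  obtain ⟨C, hC, hinter⟩ := exists_real_skip_inter_skip_le h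
  obtain ⟨N, hesc⟩ := eventually_atTop.1 (eventually_escProb_mem h)
  refine ⟨120 * C, by linarith, ?_⟩
  filter_upwards [hinter, eventually_ge_atTop N, eventually_ge_atTop 3,
    tendsto_log_log_natCast.eventually_ge_atTop 1] with j hinter hjN hj hll
  have ht := logRate_pos β hj
  have hterm : ∀ k ∈ Finset.Ioc j (j ^ 2),
      skipWeight β k * (Q (j + 1)).real (skipEvent j ∩ skipEvent k) ≤
        6 * C * (skipWeight β k * logRate β k * (1 / ((k : ℝ) - j) + 1 / j + logRate β j)) := by
    intro k hk
    obtain ⟨hjk, -⟩ := Finset.mem_Ioc.1 hk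
    have hkj : (0 : ℝ) < k - j := sub_pos.2 (by exact_mod_cast hjk)
    have hw := skipWeight_pos β (hj.trans hjk.le)
    calc skipWeight β k * (Q (j + 1)).real (skipEvent j ∩ skipEvent k)
        ≤ skipWeight β k * (C * (6 * logRate β k) *
          (1 / ((k : ℝ) - j) + 1 / j + logRate β j)) := by
          refine mul_le_mul_of_nonneg_left ((hinter k hjk).trans ?_) hw.le
          gcongr
          exact (hesc k (hjN.trans hjk.le)).2
      _ = _ := by ring
  calc _ ≤ ∑ k ∈ Finset.Ioc j (j ^ 2), 6 * C * (skipWeight β k * logRate β k *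
          (1 / ((k : ℝ) - j) + 1 / j + logRate β j)) := Finset.sum_le_sum hterm
    _ ≤ 6 * C * (5 * logRate β j) := by
        rw [← Finset.mul_sum]
        gcongr
        exact sum_skipWeight_mul_logRate_mul_le hβ hj hll
    _ ≤ 120 * C * escProb Q j := by nlinarith [(hesc j hjN).1]

theorem exists_sum_skipWeight_mul_real_le (h : IsWalkFamily (upProb (perturbation β)) Q)
    (hβ : β ≤ 1) : ∃ C : ℝ, 0 ≤ C ∧ ∀ᶠ j : ℕ in atTop, ∀ x < j,
      ∑ k ∈ Finset.Ioc j (j ^ 2), skipWeight β k * (Q x).real (skipEvent j ∩ skipEvent k) ≤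
        C * skipProb Q j x := by
  obtain ⟨N, hr⟩ := exists_isBarrierRate β
  obtain ⟨C, hC, hsucc⟩ := exists_sum_skipWeight_mul_real_succ_le h hβ
  refine ⟨C, hC, ?_⟩
  filter_upwards [hsucc, eventually_ge_atTop N] with j hsucc hjN x hx
  refine le_of_mul_le_mul_right ?_ (hr.escProb_pos h hjN)
  calc _ = skipProb Q j x * ∑ k ∈ Finset.Ioc j (j ^ 2),
        skipWeight β k * (Q (j + 1)).real (skipEvent j ∩ skipEvent k) := by
        rw [Finset.sum_mul, Finset.mul_sum]
        refine Finset.sum_congr rfl fun k hk => ?_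
        rw [mul_assoc, h.real_skip_inter_skip_mul_escProb (by omega) (Finset.mem_Ioc.1 hk).1,
          mul_left_comm]
    _ ≤ skipProb Q j x * (C * escProb Q j) := mul_le_mul_of_nonneg_left hsucc measureReal_nonneg
    _ = C * skipProb Q j x * escProb Q j := by ring

theorem eventually_real_skip_inter_skip_le_mul (h : IsWalkFamily (upProb (perturbation β)) Q) :
    ∀ᶠ j : ℕ in atTop, ∀ x < j, ∀ k, j ^ 2 < k →
      (Q x).real (skipEvent j ∩ skipEvent k) ≤ 108 * (skipProb Q j x * skipProb Q k x) := by
  obtain ⟨N, hr⟩ := exists_isBarrierRate β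
  filter_upwards [eventually_ge_atTop (N + 3), (tendsto_sum_logRate β).eventually_ge_atTop 1]
    with j hj hsum x hx k hk
  refine hr.real_skip_inter_skip_le_mul h hj hx ((Nat.le_self_pow two_ne_zero j).trans_lt hk)
    (hsum.trans <| Finset.sum_le_sum_of_subset_of_nonneg (Finset.Ioc_subset_Ioc_right hk.le)
      fun i hi _ => (logRate_pos β ?_).le)
  have := Finset.mem_Ioc.1 hi
  omega

theorem eventually_tendsto_sum_skipWeight_mul_skipProb
    (h : IsWalkFamily (upProb (perturbation β)) Q) (x : ℕ) : ∀ᶠ N in atTop,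
      Tendsto (fun n => ∑ k ∈ Finset.Ioc N n, skipWeight β k * skipProb Q k x) atTop atTop := by
  obtain ⟨N₀, hr⟩ := exists_isBarrierRate β
  obtain ⟨N₁, hesc⟩ := eventually_atTop.1 (eventually_escProb_mem h)
  filter_upwards [eventually_ge_atTop (N₀ + 3), eventually_ge_atTop N₁, eventually_ge_atTop x]
    with N hN₀ hN₁ hx
  refine tendsto_atTop_mono (fun n => ?_) ((tendsto_sum_one_div_mul_log_mul_log_log
    (show 3 ≤ N by omega)).const_mul_atTop (show (0 : ℝ) < 1 / 72 by norm_num))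
  rw [Finset.mul_sum]
  refine Finset.sum_le_sum fun k hk => ?_
  obtain ⟨hNk, -⟩ := Finset.mem_Ioc.1 hk
  have hk3 : 3 ≤ k := by omega
  have hskip := hr.escProb_div_eighteen_le_skipProb h (show N₀ + 3 ≤ k by omega)
    (show x < k by omega)
  rw [← skipWeight_mul_logRate β hk3, mul_left_comm]
  refine mul_le_mul_of_nonneg_left ?_ (skipWeight_pos β hk3).le
  linarith [(hesc k (by omega)).1]

theorem exists_second_moment_le (h : IsWalkFamily (upProb (perturbation β)) Q) (hβ : β ≤ 1) :
    ∃ C : ℝ, 0 ≤ C ∧ ∀ x, ∀ᶠ N in atTop, ∀ n,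
      ∑ j ∈ Finset.Ioc N n, ∑ k ∈ Finset.Ioc N n,
        skipWeight β j * skipWeight β k * (Q x).real (skipEvent j ∩ skipEvent k) ≤
      (1 + 2 * C) * ∑ k ∈ Finset.Ioc N n, skipWeight β k * skipProb Q k x +
        108 * (∑ k ∈ Finset.Ioc N n, skipWeight β k * skipProb Q k x) ^ 2 := by
  obtain ⟨C, hC, hnear⟩ := exists_sum_skipWeight_mul_real_le h hβ
  refine ⟨C, hC, fun x => ?_⟩
  obtain ⟨N₀, hN₀⟩ := eventually_atTop.1 (hnear.and ((eventually_real_skip_inter_skip_le_mul h).and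
    (tendsto_log_log_natCast.eventually_ge_atTop 1)))
  filter_upwards [eventually_ge_atTop N₀, eventually_ge_atTop x, eventually_ge_atTop 3]
    with N hN hx hN3 n
  have hw : ∀ k, N < k → 0 ≤ skipWeight β k := fun k hk => (skipWeight_pos β (by omega)).le
  have hI : ∀ k ∈ Finset.Ioc N n, N < k := fun k hk => (Finset.mem_Ioc.1 hk).1
  refine sum_sum_le_of_near_far (S := fun j => Finset.Ioc j (j ^ 2))
    (fun j hj k hk => mul_nonneg (mul_nonneg (hw j (hI j hj)) (hw k (hI k hk))) measureReal_nonneg)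
    (fun j k => by rw [Set.inter_comm, mul_comm (skipWeight β j)])
    (fun j hj => mul_nonneg (hw j (hI j hj)) measureReal_nonneg) (by norm_num)
    (fun j hj => ?diag) (fun j hj => ?near) (fun j hj k hk hjk hk_far => ?far)
  all_goals
    have hNj := hI j hj
    have hwj := hw j hNj
    obtain ⟨hnear, hfar, hll⟩ := hN₀ j (by omega)
  case diag =>
    rw [Set.inter_self, mul_right_comm]
    exact mul_le_of_le_one_right (mul_nonneg hwj measureReal_nonneg)
      (skipWeight_le_one hβ (by omega) hll)
  case near =>
    calc _ ≤ ∑ k ∈ Finset.Ioc j (j ^ 2),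
          skipWeight β j * skipWeight β k * (Q x).real (skipEvent j ∩ skipEvent k) :=
          Finset.sum_le_sum_of_subset_of_nonneg (fun k hk => (Finset.mem_filter.1 hk).2)
            fun k hk _ => mul_nonneg (mul_nonneg hwj
              (hw k (hNj.trans (Finset.mem_Ioc.1 hk).1))) measureReal_nonneg
      _ ≤ skipWeight β j * (C * skipProb Q j x) := by
          simp only [mul_assoc, ← Finset.mul_sum]
          exact mul_le_mul_of_nonneg_left (hnear x (by omega)) hwj
      _ = C * (skipWeight β j * skipProb Q j x) := mul_left_comm _ _ _
  case far =>
    calc _ ≤ skipWeight β j * skipWeight β k * (108 * (skipProb Q j x * skipProb Q k x)) :=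
          mul_le_mul_of_nonneg_left (hfar x (by omega) k (by simpa [hjk] using hk_far))
            (mul_nonneg hwj (hw k (hI k hk)))
      _ = _ := by ring

theorem exists_le_real_infinite_skipped (h : IsWalkFamily (upProb (perturbation β)) Q)
    (hβ : β ≤ 1) :
    ∃ c > 0, ∀ x, c ≤ (Q x).real {ω | {k | ω ∈ skipEvent k}.Infinite} := by
  obtain ⟨C, hC, hsq⟩ := exists_second_moment_le h hβ
  have hK : 0 < 109 + 2 * C := by linarith
  refine ⟨1 / (4 * (109 + 2 * C)), by positivity, fun x => ?_⟩
  obtain ⟨N, hmean, hsq⟩ :=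
    ((eventually_tendsto_sum_skipWeight_mul_skipProb h x).and (hsq x)).exists
  have := h.isProbabilityMeasure x
  refine one_div_le_real_setOf_infinite (skipWeight β) measurableSet_skipEvent hK hmean ?_
  filter_upwards [hmean.eventually_ge_atTop 1] with n hn
  refine (hsq n).trans ?_
  change _ ≤ (109 + 2 * C) * (∑ k ∈ Finset.Ioc N n, skipWeight β k * skipProb Q k x) ^ 2
  set M := ∑ k ∈ Finset.Ioc N n, skipWeight β k * skipProb Q k x
  have hM : (1 + 2 * C) * M ≤ (1 + 2 * C) * M ^ 2 := by
    gcongr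
    exact le_self_pow₀ hn two_ne_zero
  linarith

end SecondMoment

theorem measurableSet_infinite_skipped :
    MeasurableSet {ω : ℕ → ℕ | {k | ω ∈ skipEvent k}.Infinite} := by
  have hlimsup : {ω : ℕ → ℕ | {k | ω ∈ skipEvent k}.Infinite} = limsup skipEvent atTop := by
    ext ω
    rw [mem_limsup_iff_frequently_mem, Nat.frequently_atTop_iff_infinite, Set.mem_ofPred_eq]
  rw [hlimsup]
  exact MeasurableSet.measurableSet_limsup measurableSet_skipEvent

theorem preimage_consPath_finite_skipped (x : ℕ) :
    consPath x ⁻¹' {ω | {k | ω ∈ skipEvent k}.Finite} = {ω | {k | ω ∈ skipEvent k}.Finite} := by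
  ext ω
  have hskipped : {k | consPath x ω ∈ skipEvent k} = {k | ω ∈ skipEvent k} \ {x} := by
    ext k
    simp [consPath_mem_skipEvent, and_comm, eq_comm]
  rw [Set.mem_preimage, Set.mem_ofPred_eq, Set.mem_ofPred_eq, hskipped]
  exact ⟨fun hfin => hfin.of_sdiff (Set.finite_singleton x), fun hfin => hfin.sdiff⟩

theorem ae_infinite_skipped {β : ℝ} {Q : ℕ → Measure (ℕ → ℕ)}
    (h : IsWalkFamily (upProb (perturbation β)) Q) (hβ : β ≤ 1) (x : ℕ) :
    ∀ᵐ ω ∂Q x, {k | ω ∈ skipEvent k}.Infinite := by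
  obtain ⟨c, hc, hinf⟩ := exists_le_real_infinite_skipped h hβ
  have hcompl : {ω : ℕ → ℕ | {k | ω ∈ skipEvent k}.Finite} =
      {ω | {k | ω ∈ skipEvent k}.Infinite}ᶜ := by
    ext ω
    simp
  have hmeas : MeasurableSet {ω : ℕ → ℕ | {k | ω ∈ skipEvent k}.Finite} :=
    hcompl ▸ measurableSet_infinite_skipped.compl
  have hle : ∀ y, (Q y).real {ω | {k | ω ∈ skipEvent k}.Finite} ≤ 1 - c := fun y => by
    have := h.isProbabilityMeasure y
    rw [hcompl, probReal_compl_eq_one_sub measurableSet_infinite_skipped]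
    linarith [hinf y]
  have hzero := h.measure_eq_zero_of_invariant hmeas preimage_consPath_finite_skipped
    (sub_lt_self 1 hc) hle x
  rwa [hcompl, ← mem_ae_iff] at hzero

theorem theorem1p2_general {Ω : Type*} [MeasurableSpace Ω] (P : Measure Ω)
    [IsProbabilityMeasure P] (β : ℝ) (hp : ∀ n, upProb (perturbation β) n ≤ 1) (X : ℕ → Ω → ℕ)
    (hX : IsMarkovChainWith P (walkTransition (upProb (perturbation β))) X) :
    (1 < β → ∀ᵐ ω ∂P, (skippedPoints X ω).Finite) ∧
      (β ≤ 1 → ∀ᵐ ω ∂P, (skippedPoints X ω).Infinite) := by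
  obtain ⟨Q, hQ⟩ := (isUpProb_perturbation hp).exists_isWalkFamily
  exact ⟨fun hβ => hQ.ae_of_forall_ae hX (ae_finite_skipped hQ hβ),
    fun hβ => hQ.ae_of_forall_ae hX (ae_infinite_skipped hQ hβ)⟩

theorem theorem1p2 {Ω : Type*} [MeasurableSpace Ω] (P : MeasureTheory.Measure Ω)
    [MeasureTheory.IsProbabilityMeasure P] (β : ℝ)
    (hp : ∀ n : ℕ, 1 ≤ n → upProb (perturbation β) n ∈ Set.Ioo (0 : ℝ) 1)
    (X : ℕ → Ω → ℕ)
    (hX : IsMarkovChainWith P (walkTransition (upProb (perturbation β))) X) :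
    (1 < β → ∀ᵐ ω ∂P, (skippedPoints X ω).Finite) ∧
    (β ≤ 1 → (11 / 27 : ℝ) ≤ P.real {ω | (skippedPoints X ω).Infinite}) := by
  have hp_le : ∀ n, upProb (perturbation β) n ≤ 1 := fun n =>
    n.eq_zero_or_pos.elim (fun hn => by simp [upProb, hn]) fun hn => (hp n hn).2.le
  obtain ⟨hfinite, hinfinite⟩ := theorem1p2_general P β hp_le X hX
  refine ⟨hfinite, fun hβ => ?_⟩
  rw [measureReal_congr (eventuallyEq_univ.2 (hinfinite hβ)), probReal_univ]
  norm_num
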